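/- **Setting.** Let $\alpha,\beta,\gamma\in\{1,2,\infty\}$, $\mu_1,\mu_2,\rho\ge 0$, let $\mathcal A:\mathbb R^{m\times n}\to\mathbb R^q$ and $\mathcal C:\mathbb R^{m\times n}\to\mathbb R^p$ be linear with $\mathcal A$ surjective, and let $b\in\mathbb R^q$, $d\in\mathbb R^p$. Write $\sigma(X)\in\mathbb R^{\min\{m,n\}}$ for the vector of singular values of $X$, $\|\cdot\|_{\gamma^*}$ for the dual norm of $\|\cdot\|_\gamma$, and $$F(X)=\mu_1\|\sigma(X)\|_\alpha+\mu_2\|\mathcal C(X)-d\|_\beta .$$ The composite norm minimization problem is $\min\{F(X): X\in\mathbb R^{m\times n},\ \|\mathcal A(X)-b\|_\gamma\le\rho\}$. **Algorithm (FALC).** Given parameters $(\lambda^{(k)},\epsilon^{(k)},\tau^{(k)},\xi^{(k)})_{k\ge1}$ with $\lambda^{(k)},\epsilon^{(k)}>0$ and a matrix $X^{(0)}$ with $\mathcal A(X^{(0)})=b$, put $\theta_1^{(1)}=0$, $\theta_2^{(1)}=0$ and, for $k\ge1$, $$P^{(k)}(X,s,y)=\lambda^{(k)}\big(\mu_1\|\sigma(X)\|_\alpha+\mu_2\|s\|_\beta\big)+\tfrac12\|\mathcal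 A(X)+y-b-\lambda^{(k)}\theta_1^{(k)}\|_2^2+\tfrac12\|\mathcal C(X)+s-d-\lambda^{(k)}\theta_2^{(k)}\|_2^2 ,$$ $$\eta^{(k)}=F(X^{(0)})+\tfrac{\lambda^{(k)}}2\big(\|\theta_1^{(k)}\|_2^2+\|\theta_2^{(k)}\|_2^2\big).$$ In step $k$ an inner solver for the subproblem $\min\{P^{(k)}(X,s,y):X\in\mathbb R^{m\times n},\ s\in\mathbb R^p,\ \|y\|_\gamma\le\rho\}$ returns a feasible point $(X^{(k)},s^{(k)},y^{(k)})$ of this subproblem such that either (a) $P^{(k)}(X^{(k)},s^{(k)},y^{(k)})\le\inf\{P^{(k)}(X,s,y):\|y\|_\gamma\le\rho\}+\epsilon^{(k)}$, or (b) $\sqrt{\|G\|_F^2+\|g\|_2^2}\le\tau^{(k)}$ for some partial subgradient $(G,g)$ of $P^{(k)}$ with respect to $(X,s)$ at $(X^{(k)},s^{(k)},y^{(k)})$, and $\mu_1\|\sigma(X^{(k)})\|_\alpha\le\eta^{(k)}$, and $\rho\|v\|_{\gamma^*}+v^Ty^{(k)}\le\xi^{(k)}$, where $v=\nabla_yP^{(k)}(X^{(k)},s^{(k)},y^{(k)})$.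 Then $\theta_1^{(k+1)}=\theta_1^{(k)}-\big(\mathcal A(X^{(k)})+y^{(k)}-b\big)/\lambda^{(k)}$ and $\theta_2^{(k+1)}=\theta_2^{(k)}-\big(\mathcal C(X^{(k)})+s^{(k)}-d\big)/\lambda^{(k)}$. **Theorem.** Let $\{(X^{(k)},s^{(k)},y^{(k)})\}_{k\ge1}$ be generated by FALC. Suppose that there are constants $B,\kappa_1,\kappa_2$ with $\epsilon^{(k)}/(\lambda^{(k)})^2\le B$, $\tau^{(k)}=\kappa_1\epsilon^{(k)}$ and $\xi^{(k)}=\kappa_2\epsilon^{(k)}$ for all $k\ge1$, and that $\tau^{(k)}/\lambda^{(k)}\to0$ and $\xi^{(k)}/\lambda^{(k)}\to0$ as $k\to\infty$ (which is automatic when $\lambda^{(k)}\to0$). Then there are constants $c_1,c_2,c_3>0$ such that for all $k\ge1$: (i) $\|y^{(k)}\|_\gamma\le\rho$ and $\|\mathcal A(X^{(k)})+y^{(k)}-b\|_2\le c_1\lambda^{(k)}$; (ii) $|F(X^{(k)})-F(X_*)|\le c_2\lambda^{(k)}+c_3\sqrt{\epsilon^{(k)}}$ for every optimal solution $X_*$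 of the composite norm minimization problem. -/

import Mathlib

open Filter Topology
open scoped ENNReal

noncomputable section

namespace FALC

/-- The `ℓ_p`-norm of a finite real vector. -/
def vecNorm (p : ℝ≥0∞) {ι : Type} [Fintype ι] (v : ι → ℝ) : ℝ :=
  ‖(WithLp.toLp p v : PiLp p (fun _ : ι => ℝ))‖

/-- The dual norm of the `ℓ_p`-norm, `v ↦ max {⟨w, v⟩ : ‖w‖_p ≤ 1}`. -/
def dualNorm (p : ℝ≥0∞) {k : ℕ} (v : EuclideanSpace ℝ (Fin k)) : ℝ :=
  sSup {t : ℝ | ∃ w : EuclideanSpace ℝ (Fin k), vecNorm p w ≤ 1 ∧ t = inner ℝ w v}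

/-- The vector `σ(X)` of the `min m n` singular values of `X`, in decreasing order. -/
def sigma {m n : ℕ} (X : Matrix (Fin m) (Fin n) ℝ) : Fin (min m n) → ℝ :=
  fun i => (Matrix.toEuclideanLin X).singularValues i

/-- The inner product `⟨G, X⟩ = Tr (Gᵀ X)` of matrices. -/
def frobInner {m n : ℕ} (G X : Matrix (Fin m) (Fin n) ℝ) : ℝ :=
  (G.transpose * X).trace

/-- The Frobenius norm. -/
def frobNorm {m n : ℕ} (G : Matrix (Fin m) (Fin n) ℝ) : ℝ :=
  √(frobInner G G)

/-- The data of the composite norm minimization problem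
`min μ₁ ‖σ(X)‖_α + μ₂ ‖C(X) - d‖_β` subject to `‖A(X) - b‖_γ ≤ ρ`. -/
structure Problem (m n p q : ℕ) where
  α : ℝ≥0∞
  β : ℝ≥0∞
  γ : ℝ≥0∞
  μ₁ : ℝ
  μ₂ : ℝ
  ρ : ℝ
  A : Matrix (Fin m) (Fin n) ℝ →ₗ[ℝ] EuclideanSpace ℝ (Fin q)
  C : Matrix (Fin m) (Fin n) ℝ →ₗ[ℝ] EuclideanSpace ℝ (Fin p)
  b : EuclideanSpace ℝ (Fin q)
  d : EuclideanSpace ℝ (Fin p)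
  α_mem : α = 1 ∨ α = 2 ∨ α = ∞
  β_mem : β = 1 ∨ β = 2 ∨ β = ∞
  γ_mem : γ = 1 ∨ γ = 2 ∨ γ = ∞
  μ₁_nonneg : 0 ≤ μ₁
  μ₂_nonneg : 0 ≤ μ₂
  ρ_nonneg : 0 ≤ ρ
  A_surjective : Function.Surjective A

namespace Problem

variable {m n p q : ℕ} (D : Problem m n p q)

/-- The objective function `μ₁ ‖σ(X)‖_α + μ₂ ‖C(X) - d‖_β`. -/
def objective (X : Matrix (Fin m) (Fin n) ℝ) : ℝ :=
  D.μ₁ * vecNorm D.α (sigma X) + D.μ₂ * vecNorm D.β (D.C X - D.d)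

/-- `X` satisfies the constraint `‖A(X) - b‖_γ ≤ ρ`. -/
def Feasible (X : Matrix (Fin m) (Fin n) ℝ) : Prop :=
  vecNorm D.γ (D.A X - D.b) ≤ D.ρ

/-- `X` is an optimal solution of the composite norm minimization problem. -/
def IsOptimal (X : Matrix (Fin m) (Fin n) ℝ) : Prop :=
  D.Feasible X ∧ ∀ X', D.Feasible X' → D.objective X ≤ D.objective X'

/-- The augmented Lagrangian function
`P(X, s, y) = λ (μ₁ ‖σ(X)‖_α + μ₂ ‖s‖_β)
  + ½ ‖A(X) + y - b - λ θ₁‖₂² + ½ ‖C(X) + s - d - λ θ₂‖₂²`. -/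
def P (lam : ℝ) (θ₁ : EuclideanSpace ℝ (Fin q)) (θ₂ : EuclideanSpace ℝ (Fin p))
    (X : Matrix (Fin m) (Fin n) ℝ) (s : EuclideanSpace ℝ (Fin p))
    (y : EuclideanSpace ℝ (Fin q)) : ℝ :=
  lam * (D.μ₁ * vecNorm D.α (sigma X) + D.μ₂ * vecNorm D.β s)
    + 1 / 2 * ‖D.A X + y - D.b - lam • θ₁‖ ^ 2
    + 1 / 2 * ‖D.C X + s - D.d - lam • θ₂‖ ^ 2

/-- The infimum of `P` over the set of all `(X, s, y)` with `‖y‖_γ ≤ ρ`. -/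
def infP (lam : ℝ) (θ₁ : EuclideanSpace ℝ (Fin q)) (θ₂ : EuclideanSpace ℝ (Fin p)) : ℝ :=
  sInf {t : ℝ | ∃ (X : Matrix (Fin m) (Fin n) ℝ) (s : EuclideanSpace ℝ (Fin p))
    (y : EuclideanSpace ℝ (Fin q)), vecNorm D.γ y ≤ D.ρ ∧ t = D.P lam θ₁ θ₂ X s y}

/-- `(G, g)` is a partial subgradient of `P` with respect to `(X, s)` at the point `(X, s, y)`. -/
def IsPartialSubgradient (lam : ℝ) (θ₁ : EuclideanSpace ℝ (Fin q))
    (θ₂ : EuclideanSpace ℝ (Fin p)) (X : Matrix (Fin m) (Fin n) ℝ)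
    (s : EuclideanSpace ℝ (Fin p)) (y : EuclideanSpace ℝ (Fin q))
    (G : Matrix (Fin m) (Fin n) ℝ) (g : EuclideanSpace ℝ (Fin p)) : Prop :=
  ∀ X' s', D.P lam θ₁ θ₂ X s y + frobInner G (X' - X) + inner ℝ g (s' - s)
    ≤ D.P lam θ₁ θ₂ X' s' y

/-- The partial gradient of `P` with respect to `y` at the point `(X, s, y)`. -/
def gradY (lam : ℝ) (θ₁ : EuclideanSpace ℝ (Fin q)) (θ₂ : EuclideanSpace ℝ (Fin p))
    (X : Matrix (Fin m) (Fin n) ℝ) (s : EuclideanSpace ℝ (Fin p))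
    (y : EuclideanSpace ℝ (Fin q)) : EuclideanSpace ℝ (Fin q) :=
  gradient (fun y' => D.P lam θ₁ θ₂ X s y') y

/-- The first stopping condition of the inner iteration: `ε`-optimality. -/
def StopA (lam eps : ℝ) (θ₁ : EuclideanSpace ℝ (Fin q)) (θ₂ : EuclideanSpace ℝ (Fin p))
    (X : Matrix (Fin m) (Fin n) ℝ) (s : EuclideanSpace ℝ (Fin p))
    (y : EuclideanSpace ℝ (Fin q)) : Prop :=
  D.P lam θ₁ θ₂ X s y ≤ D.infP lam θ₁ θ₂ + eps

/-- The second stopping condition of the inner iteration: approximate stationarity, with tolerance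
`tau` in `(X, s)` and tolerance `xi` in `y`, and the norm bound `μ₁ ‖σ(X)‖_α ≤ eta`. -/
def StopB (lam tau xi eta : ℝ) (θ₁ : EuclideanSpace ℝ (Fin q)) (θ₂ : EuclideanSpace ℝ (Fin p))
    (X : Matrix (Fin m) (Fin n) ℝ) (s : EuclideanSpace ℝ (Fin p))
    (y : EuclideanSpace ℝ (Fin q)) : Prop :=
  (∃ G g, D.IsPartialSubgradient lam θ₁ θ₂ X s y G g ∧ √(frobNorm G ^ 2 + ‖g‖ ^ 2) ≤ tau) ∧
  D.μ₁ * vecNorm D.α (sigma X) ≤ eta ∧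
  D.ρ * dualNorm D.γ (D.gradY lam θ₁ θ₂ X s y) + inner ℝ (D.gradY lam θ₁ θ₂ X s y) y ≤ xi

/-- The sequences `X, s, y, θ₁, θ₂` are generated by the first-order augmented Lagrangian algorithm
with parameters `lam, eps, tau, xi`. The outer iterations are `k = 1, 2, …`; `X 0` is the initial
matrix (the remaining entries with index `0` play no role). In the `k`-th outer iteration any point
of the feasible set `{(X, s, y) : ‖y‖_γ ≤ ρ}` of the `k`-th subproblem that meets one of the two
stopping conditions may be returned by the inner solver. -/
structure IsRun (lam eps tau xi : ℕ → ℝ) (X : ℕ → Matrix (Fin m) (Fin n) ℝ)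
    (s : ℕ → EuclideanSpace ℝ (Fin p)) (y : ℕ → EuclideanSpace ℝ (Fin q))
    (θ₁ : ℕ → EuclideanSpace ℝ (Fin q)) (θ₂ : ℕ → EuclideanSpace ℝ (Fin p)) : Prop where
  init : D.A (X 0) = D.b
  θ₁_one : θ₁ 1 = 0
  θ₂_one : θ₂ 1 = 0
  inner_feasible : ∀ k, 1 ≤ k → vecNorm D.γ (y k) ≤ D.ρ
  inner_stop : ∀ k, 1 ≤ k →
    D.StopA (lam k) (eps k) (θ₁ k) (θ₂ k) (X k) (s k) (y k) ∨
    D.StopB (lam k) (tau k) (xi k)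
      (D.objective (X 0) + lam k / 2 * (‖θ₁ k‖ ^ 2 + ‖θ₂ k‖ ^ 2))
      (θ₁ k) (θ₂ k) (X k) (s k) (y k)
  θ₁_succ : ∀ k, 1 ≤ k → θ₁ (k + 1) = θ₁ k - (lam k)⁻¹ • (D.A (X k) + y k - D.b)
  θ₂_succ : ∀ k, 1 ≤ k → θ₂ (k + 1) = θ₂ k - (lam k)⁻¹ • (D.C (X k) + s k - D.d)

end Problem

end FALC

end

/-! ### Singular values of a linear map between Euclidean spaces. -/

section SingularValues

variable {E F : Type*} [NormedAddCommGroup E] [InnerProductSpace ℝ E] [FiniteDimensional ℝ E]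
  [NormedAddCommGroup F] [InnerProductSpace ℝ F] [FiniteDimensional ℝ F]

/-! For the three exponents, `‖σ(X)‖_α` is the nuclear, Frobenius or spectral norm. After
vectorizing matrices, the problem is to minimize `f x + h (C x - d)` with seminorms `f`, `h` on
Euclidean spaces.

Residuals (`exists_residual_bound`, `AugLagRun.exists_bound`): a step of length `λ` against a
shifted residual `r` lowers the quadratic penalty by `λ‖r‖` to first order and changes all else by
`O(λ²)`. Approximate optimality or stationarity forbids a gain beyond `O(λ²)`, so `r = O(λ)`. The
next multiplier is `-r/λ`, so the multipliers stay bounded and the unshifted residuals are `O(λ)`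
too.

Lower bound (`objective_lower_bound`): surjectivity of `A` lets a correction of size `O(λ)` make the
iterate feasible.

Upper bound (`exists_objective_le`): the subproblem point is compared with an optimal solution.
Under ε-optimality this is direct. Under stationarity, the linearized subgradient inequality leaves
errors `ξ/λ = O(λ)` and `τ/λ` times a distance. That distance is affinely bounded by the objective
value (`exists_dist_bound`), so `τ/λ → 0` allows absorbing it for large `k`; the finitely many other
indices only enlarge the constant. -/

/-- The right singular vectors of `T`: an orthonormal basis whose image under `T` is orthogonal. -/
theorem exists_rightSingularBasis {n : ℕ} (hn : Module.finrank ℝ E = n) (T : E →ₗ[ℝ] F) :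
    ∃ v : OrthonormalBasis (Fin n) ℝ E, ∀ i j,
      inner ℝ (T (v i)) (T (v j)) = if i = j then T.singularValues i ^ 2 else 0 := by
  refine ⟨T.isSymmetric_adjoint_comp_self.eigenvectorBasis hn, fun i j => ?_⟩
  rw [← LinearMap.adjoint_inner_right, ← LinearMap.comp_apply,
    LinearMap.IsSymmetric.apply_eigenvectorBasis, inner_smul_right,
    orthonormal_iff_ite.1 (OrthonormalBasis.orthonormal _), ← T.sq_singularValues_fin hn]
  split_ifs with h
  · simp [h]
  · simp

/-- A singular value decomposition; the left singular vectors satisfy Bessel's inequality. -/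
theorem exists_singularDecomposition {n : ℕ} (hn : Module.finrank ℝ E = n) (T : E →ₗ[ℝ] F) :
    ∃ (v : OrthonormalBasis (Fin n) ℝ E) (u : Fin n → F),
      (∀ z, ∑ i, (inner ℝ (u i) z : ℝ) ^ 2 ≤ ‖z‖ ^ 2) ∧
      (∀ i, T (v i) = T.singularValues i • u i) ∧
      (∀ i, inner ℝ (u i) (T (v i)) = T.singularValues i) ∧
      ∀ i, ‖T (v i)‖ = T.singularValues i := by
  obtain ⟨v, hv⟩ := exists_rightSingularBasis hn T
  have hnorm : ∀ i, ‖T (v i)‖ = T.singularValues i := fun i => by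
    have h := hv i i
    rw [real_inner_self_eq_norm_sq, if_pos rfl] at h
    exact (sq_eq_sq₀ (norm_nonneg _) (T.singularValues_nonneg i)).1 h
  -- Since `0⁻¹ = 0`, the left vector is `0` where the singular value vanishes; hence Bessel's
  -- inequality rather than orthonormality.
  refine ⟨v, fun i => (T.singularValues i)⁻¹ • T (v i), fun z => ?_, fun i => ?_, fun i => ?_,
    hnorm⟩
  · have ho : Orthonormal ℝ (fun i : {i : Fin n // T.singularValues i ≠ 0} =>
        (T.singularValues i.1)⁻¹ • T (v i.1)) := by
      rw [orthonormal_iff_ite]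
      intro i j
      rw [inner_smul_left, inner_smul_right, hv]
      by_cases h : i = j
      · subst h
        have := i.2
        simp only [if_true, RCLike.conj_to_real]
        field_simp
      · have h' : i.1 ≠ j.1 := fun e => h (Subtype.ext e)
        simp [h, h']
    have hb := ho.sum_inner_products_le z (s := Finset.univ)
    simp only [Real.norm_eq_abs, sq_abs] at hb
    refine le_trans (le_of_eq ?_) hb
    rw [← Finset.sum_subtype (Finset.univ.filter fun i : Fin n => T.singularValues i ≠ 0)
      (by simp) (fun i => (inner ℝ ((T.singularValues i)⁻¹ • T (v i)) z : ℝ) ^ 2)]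
    rw [Finset.sum_filter_of_ne]
    intro i _ hi h
    simp [h] at hi
  · by_cases h : T.singularValues i = 0
    · have := hnorm i
      rw [h, norm_eq_zero] at this
      simp [this]
    · rw [smul_smul, mul_inv_cancel₀ h, one_smul]
  · rw [inner_smul_left, hv, if_pos rfl, RCLike.conj_to_real]
    by_cases h : T.singularValues i = 0
    · simp [h]
    · field_simp

/-- The images of the right singular vectors are orthogonal, so `‖T x‖²` is the sum of `σᵢ² ⟨vᵢ,
x⟩²`. -/
theorem norm_apply_le_of_singularValues_le (T : E →ₗ[ℝ] F) {M : ℝ}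
    (hM : ∀ i, T.singularValues i ≤ M) (x : E) : ‖T x‖ ≤ M * ‖x‖ := by
  have hM0 : 0 ≤ M := (T.singularValues_nonneg 0).trans (hM 0)
  obtain ⟨v, hv⟩ := exists_rightSingularBasis rfl T
  refine le_of_sq_le_sq ?_ (by positivity)
  have hx : T x = ∑ i, inner ℝ (v i) x • T (v i) := by
    conv_lhs => rw [← v.sum_repr' x]
    simp
  rw [mul_pow, ← v.sum_sq_norm_inner_right x, ← real_inner_self_eq_norm_sq, hx, sum_inner,
    Finset.mul_sum]
  refine Finset.sum_le_sum fun i _ => ?_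
  simp only [inner_sum, inner_smul_left, inner_smul_right, hv]
  simp only [mul_ite, mul_zero, Finset.sum_ite_eq, Finset.mem_univ, if_true, RCLike.conj_to_real,
    Real.norm_eq_abs, sq_abs]
  have h2 : T.singularValues i ^ 2 ≤ M ^ 2 :=
    pow_le_pow_left₀ (T.singularValues_nonneg _) (hM _) 2
  nlinarith [mul_le_mul_of_nonneg_right h2 (sq_nonneg (inner ℝ (v i) x : ℝ))]

theorem singularValues_le_of_norm_apply_le (T : E →ₗ[ℝ] F) {M : ℝ} (hM : 0 ≤ M)
    (h : ∀ x, ‖T x‖ ≤ M * ‖x‖) (i : ℕ) : T.singularValues i ≤ M := by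
  obtain hi | hi := lt_or_ge i (Module.finrank ℝ E)
  · obtain ⟨v, u, -, -, -, hv⟩ := exists_singularDecomposition rfl T
    simpa [hv] using h (v ⟨i, hi⟩)
  · rwa [T.singularValues_of_finrank_le hi]

/-- The sum of the singular values dominates the pairing with any partial isometry. -/
theorem abs_sum_inner_le_sum_singularValues {n : ℕ} (hn : Module.finrank ℝ E = n)
    (T : E →ₗ[ℝ] F) (v : OrthonormalBasis (Fin n) ℝ E) (u : Fin n → F)
    (hu : ∀ z, ∑ i, (inner ℝ (u i) z : ℝ) ^ 2 ≤ ‖z‖ ^ 2) :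
    |∑ i, (inner ℝ (u i) (T (v i)) : ℝ)| ≤ ∑ i : Fin n, T.singularValues i := by
  obtain ⟨w, t, ht, hw, -, -⟩ := exists_singularDecomposition hn T
  -- Cauchy–Schwarz, with Parseval for `v` and Bessel for `u`. That `‖t j‖ ≤ 1` follows from Bessel
  -- for `t` tested on `t j` itself.
  have key : ∀ j, |∑ i, (inner ℝ (w j) (v i) : ℝ) * inner ℝ (u i) (t j)| ≤ 1 := by
    intro j
    have htj : ‖t j‖ ^ 2 ≤ 1 := by
      have h1 := (Finset.single_le_sum (f := fun i => (inner ℝ (t i) (t j) : ℝ) ^ 2)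
        (fun i _ => sq_nonneg _) (Finset.mem_univ j)).trans (ht (t j))
      simp only [real_inner_self_eq_norm_sq] at h1
      nlinarith [sq_nonneg ‖t j‖]
    have h2 := Finset.sum_mul_sq_le_sq_mul_sq Finset.univ
      (fun i => (inner ℝ (w j) (v i) : ℝ)) (fun i => (inner ℝ (u i) (t j) : ℝ))
    have h3 : ∑ i, (inner ℝ (w j) (v i) : ℝ) ^ 2 = 1 := by
      have := v.sum_sq_norm_inner_left (w j)
      simpa using this
    rw [h3, one_mul] at h2
    rw [← sq_le_one_iff_abs_le_one]
    exact h2.trans ((hu _).trans htj)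
  have hsum : ∑ i, (inner ℝ (u i) (T (v i)) : ℝ) =
      ∑ j : Fin n, T.singularValues j * ∑ i, (inner ℝ (w j) (v i) : ℝ) * inner ℝ (u i) (t j) := by
    simp only [Finset.mul_sum]
    rw [Finset.sum_comm]
    refine Finset.sum_congr rfl fun i _ => ?_
    conv_lhs => rw [← w.sum_repr' (v i)]
    simp only [map_sum, map_smul, inner_sum, inner_smul_right, hw]
    exact Finset.sum_congr rfl fun j _ => by ring
  rw [hsum]
  refine (Finset.abs_sum_le_sum_abs _ _).trans (Finset.sum_le_sum fun j _ => ?_)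
  rw [abs_mul, abs_of_nonneg (T.singularValues_nonneg j)]
  exact mul_le_of_le_one_right (T.singularValues_nonneg j) (key j)

/-- Duality: the singular vectors of `S + T` express its nuclear norm as a pairing linear in the
operator, and the pairings with `S` and `T` are bounded by their own nuclear norms. -/
theorem sum_singularValues_add_le {n : ℕ} (hn : Module.finrank ℝ E = n) (S T : E →ₗ[ℝ] F) :
    ∑ i : Fin n, (S + T).singularValues i ≤
      ∑ i : Fin n, S.singularValues i + ∑ i : Fin n, T.singularValues i := by
  obtain ⟨v, u, hu, -, h, -⟩ := exists_singularDecomposition hn (S + T)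
  simp only [← h, LinearMap.add_apply, inner_add_right, Finset.sum_add_distrib]
  exact add_le_add ((le_abs_self _).trans (abs_sum_inner_le_sum_singularValues hn S v u hu))
    ((le_abs_self _).trans (abs_sum_inner_le_sum_singularValues hn T v u hu))

theorem sum_singularValues_smul_le {n : ℕ} (hn : Module.finrank ℝ E = n) (a : ℝ) (T : E →ₗ[ℝ] F) :
    ∑ i : Fin n, (a • T).singularValues i ≤ |a| * ∑ i : Fin n, T.singularValues i := by
  obtain ⟨v, u, hu, -, h, -⟩ := exists_singularDecomposition hn (a • T)
  simp only [← h, LinearMap.smul_apply, inner_smul_right, ← Finset.mul_sum]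
  refine (le_abs_self _).trans ?_
  rw [abs_mul]
  exact mul_le_mul_of_nonneg_left (abs_sum_inner_le_sum_singularValues hn T v u hu) (abs_nonneg a)

/-- Both sides are the trace of `T* T`, computed in two orthonormal bases. -/
theorem sum_sq_singularValues {n : ℕ} (hn : Module.finrank ℝ E = n) (T : E →ₗ[ℝ] F)
    {ι : Type*} [Fintype ι] (e : OrthonormalBasis ι ℝ E) :
    ∑ i : Fin n, T.singularValues i ^ 2 = ∑ j, ‖T (e j)‖ ^ 2 := by
  obtain ⟨v, hv⟩ := exists_rightSingularBasis hn T
  have h := (LinearMap.trace_eq_sum_inner (T.adjoint ∘ₗ T) v).symm.trans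
    (LinearMap.trace_eq_sum_inner (T.adjoint ∘ₗ T) e)
  simp only [LinearMap.comp_apply, LinearMap.adjoint_inner_right, hv, if_true] at h
  simpa using h

end SingularValues

/-! ### Norms of the singular value vector of a matrix. -/

namespace FALC

variable {m n : ℕ}

/-- Singular values with index at least the rank vanish, so passing from `min m n` to `n` terms only
adds copies of `g 0`. -/
theorem sum_sigma_eq (X : Matrix (Fin m) (Fin n) ℝ) (g : ℝ → ℝ) (hg : g 0 = 0) :
    ∑ i, g (sigma X i) = ∑ i : Fin n, g ((Matrix.toEuclideanLin X).singularValues i) := by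
  unfold sigma
  rw [Fin.sum_univ_eq_sum_range (fun i => g ((Matrix.toEuclideanLin X).singularValues i)),
    Fin.sum_univ_eq_sum_range (fun i => g ((Matrix.toEuclideanLin X).singularValues i))]
  refine Finset.sum_subset (Finset.range_mono (min_le_right m n)) fun i hi hi' => ?_
  rw [(LinearMap.singularValues_eq_zero_iff_le_finrank_range _).2, hg]
  have := (LinearMap.range (Matrix.toEuclideanLin X)).finrank_le
  simp at this hi hi'
  omega

theorem sigma_nonneg (X : Matrix (Fin m) (Fin n) ℝ) (i) : 0 ≤ sigma X i :=
  LinearMap.singularValues_nonneg _ _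

theorem vecNorm_one_sigma (X : Matrix (Fin m) (Fin n) ℝ) :
    vecNorm 1 (sigma X) = ∑ i : Fin n, (Matrix.toEuclideanLin X).singularValues i := by
  rw [vecNorm, PiLp.norm_eq_of_L1]
  refine Eq.trans ?_ (sum_sigma_eq X id rfl)
  exact Finset.sum_congr rfl fun i _ => abs_of_nonneg (sigma_nonneg X i)

/-- The largest singular value is the operator norm; in this form the seminorm axioms can be checked
pointwise. -/
theorem vecNorm_top_sigma_le_iff (X : Matrix (Fin m) (Fin n) ℝ) {M : ℝ} (hM : 0 ≤ M) :
    vecNorm ∞ (sigma X) ≤ M ↔ ∀ x, ‖Matrix.toEuclideanLin X x‖ ≤ M * ‖x‖ := by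
  have h : vecNorm ∞ (sigma X) ≤ M ↔ ∀ i, sigma X i ≤ M := by
    rw [vecNorm, PiLp.norm_toLp, pi_norm_le_iff_of_nonneg hM]
    exact forall_congr' fun i => by rw [Real.norm_of_nonneg (sigma_nonneg X i)]
  rw [h]
  constructor
  · intro h x
    refine norm_apply_le_of_singularValues_le _ (fun i => ?_) x
    by_cases hi : i < min m n
    · exact h ⟨i, hi⟩
    · rw [(LinearMap.singularValues_eq_zero_iff_le_finrank_range _).2]
      · exact hM
      · have h1 := (LinearMap.range (Matrix.toEuclideanLin X)).finrank_le
        have h2 := LinearMap.finrank_range_le (Matrix.toEuclideanLin X)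
        simp at h1 h2
        omega
  · exact fun h i => singularValues_le_of_norm_apply_le _ hM h _

/-- The identification of matrices, with the Frobenius inner product, with a Euclidean space. -/
noncomputable def vecEquiv (m n : ℕ) :
    Matrix (Fin m) (Fin n) ℝ ≃ₗ[ℝ] EuclideanSpace ℝ (Fin n × Fin m) where
  toFun X := WithLp.toLp 2 fun ij => X ij.2 ij.1
  invFun x := Matrix.of fun i j => x (j, i)
  map_add' _ _ := rfl
  map_smul' _ _ := rfl
  left_inv _ := rfl
  right_inv _ := rfl

@[simp]
theorem vecEquiv_apply (X : Matrix (Fin m) (Fin n) ℝ) (ij : Fin n × Fin m) :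
    vecEquiv m n X ij = X ij.2 ij.1 := rfl

theorem frobInner_eq (G X : Matrix (Fin m) (Fin n) ℝ) :
    frobInner G X = inner ℝ (vecEquiv m n G) (vecEquiv m n X) := by
  simp [frobInner, Matrix.trace, Matrix.mul_apply, PiLp.inner_apply,
    Fintype.sum_prod_type, mul_comm]

theorem frobNorm_eq (G : Matrix (Fin m) (Fin n) ℝ) : frobNorm G = ‖vecEquiv m n G‖ := by
  rw [frobNorm, frobInner_eq, real_inner_self_eq_norm_sq, Real.sqrt_sq (norm_nonneg _)]

/-- The sum of squares is a trace, evaluated on the standard basis as the squared lengths of the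
columns. The column-first indexing of `vecEquiv` matches this. -/
theorem vecNorm_two_sigma (X : Matrix (Fin m) (Fin n) ℝ) :
    vecNorm 2 (sigma X) = ‖vecEquiv m n X‖ := by
  rw [vecNorm, PiLp.norm_eq_of_L2, EuclideanSpace.norm_eq]
  congr 1
  simp only [Real.norm_eq_abs, sq_abs]
  rw [sum_sigma_eq X (· ^ 2) (by simp), sum_sq_singularValues (by simp) _
    (EuclideanSpace.basisFun (Fin n) ℝ), Fintype.sum_prod_type]
  refine Finset.sum_congr rfl fun j _ => ?_
  rw [EuclideanSpace.norm_sq_eq]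
  simp [Matrix.toLpLin_apply]

end FALC

/-! ### Perturbation inequalities for the augmented Lagrangian. -/

section ProximalInequalities

variable {E S Q : Type*} [NormedAddCommGroup E] [InnerProductSpace ℝ E]
  [NormedAddCommGroup S] [InnerProductSpace ℝ S] [NormedAddCommGroup Q] [InnerProductSpace ℝ Q]

theorem exists_inner_eq_neg_norm (r : Q) : ∃ w : Q, ‖w‖ ≤ 1 ∧ (inner ℝ r w : ℝ) = -‖r‖ := by
  by_cases hr : r = 0
  · exact ⟨0, by simp [hr]⟩
  · have h : ‖r‖ ≠ 0 := norm_ne_zero_iff.2 hr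
    refine ⟨-(‖r‖⁻¹ • r), ?_, ?_⟩
    · rw [norm_neg, norm_smul, norm_inv, norm_norm, inv_mul_cancel₀ h]
    · rw [inner_neg_right, inner_smul_right, real_inner_self_eq_norm_sq]
      field_simp

/-- The residuals of an approximate minimizer of the augmented Lagrangian are `O(λ)`. -/
theorem exists_residual_bound (f : Seminorm ℝ E) (h : Seminorm ℝ S) (A : E →ₗ[ℝ] Q) (C : E →ₗ[ℝ] S)
    (R : Q →ₗ[ℝ] E) (hAR : ∀ z, A (R z) = z) {Kf Kh KC KR : ℝ} (hKf : 0 ≤ Kf) (hKh : 0 ≤ Kh)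
    (hKC : 0 ≤ KC) (hf : ∀ x, f x ≤ Kf * ‖x‖) (hh : ∀ s, h s ≤ Kh * ‖s‖)
    (hC : ∀ x, ‖C x‖ ≤ KC * ‖x‖) (hR : ∀ z, ‖R z‖ ≤ KR * ‖z‖) (hKR : 0 ≤ KR) (B T : ℝ)
    (hT : 0 ≤ T) :
    ∃ K, ∀ (lam e tau : ℝ) (x : E) (s : S) (r₁ : Q) (r₂ : S), 0 < lam → e ≤ B * lam ^ 2 →
      tau ≤ T * lam →
      (∀ u w, lam * (f x + h s) + 1 / 2 * ‖r₁‖ ^ 2 + 1 / 2 * ‖r₂‖ ^ 2 ≤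
        lam * (f (x + u) + h (s + w)) + 1 / 2 * ‖r₁ + A u‖ ^ 2 + 1 / 2 * ‖r₂ + (C u + w)‖ ^ 2
          + e + tau * (‖u‖ + ‖w‖)) →
      ‖r₁‖ ≤ K * lam ∧ ‖r₂‖ ≤ K * lam := by
  -- The summands are the `λ²`-coefficients contributed by `h`, the squared step, `e` and `tau`; the
  -- last term of `K₁` pays for the cross term with `r₂`.
  set K₂ := Kh + 1 / 2 + B + T with hK₂
  set K₁ := Kf * KR + 1 / 2 + 1 / 2 * (KC * KR) ^ 2 + B + T * KR + K₂ * (KC * KR) with hK₁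
  refine ⟨max K₁ K₂, fun lam e tau x s r₁ r₂ hlam he htau H => ?_⟩
  have b₂ : ‖r₂‖ ≤ K₂ * lam := by
    obtain ⟨w, hw, hrw⟩ := exists_inner_eq_neg_norm r₂
    have H1 := H 0 (lam • w)
    simp only [add_zero, map_zero, zero_add, norm_zero] at H1
    rw [norm_add_sq_real, inner_smul_right, hrw, norm_smul, Real.norm_of_nonneg hlam.le] at H1
    have h1 : h (s + lam • w) ≤ h s + lam * Kh := by
      refine (map_add_le_add h _ _).trans ?_
      rw [map_smul_eq_mul, Real.norm_of_nonneg hlam.le]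
      gcongr
      exact (hh w).trans (mul_le_of_le_one_right hKh hw)
    have h2 : lam * h (s + lam • w) ≤ lam * (h s + lam * Kh) := by gcongr
    have h3 : (lam * ‖w‖) ^ 2 ≤ lam ^ 2 := by
      rw [mul_pow]; exact mul_le_of_le_one_right (sq_nonneg _) (pow_le_one₀ (norm_nonneg _) hw)
    have h4 : tau * (lam * ‖w‖) ≤ T * lam * lam := by
      refine (mul_le_mul_of_nonneg_right htau (by positivity)).trans ?_
      exact mul_le_mul_of_nonneg_left (mul_le_of_le_one_right hlam.le hw) (by positivity)
    have h5 : lam * ‖r₂‖ ≤ lam * (K₂ * lam) := by rw [hK₂]; nlinarith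
    exact le_of_mul_le_mul_left h5 hlam
  -- Moving `x` by `λ R w` shifts `A x` by exactly `λ w` but also moves `C x`; the bound on `r₂`
  -- controls the resulting cross term.
  have b₁ : ‖r₁‖ ≤ K₁ * lam := by
    obtain ⟨w, hw, hrw⟩ := exists_inner_eq_neg_norm r₁
    have H1 := H (lam • R w) 0
    simp only [add_zero, map_smul, hAR, norm_zero] at H1
    rw [norm_add_sq_real, norm_add_sq_real, inner_smul_right, inner_smul_right, hrw, norm_smul,
      norm_smul, norm_smul, Real.norm_of_nonneg hlam.le] at H1
    have hRw : ‖R w‖ ≤ KR := (hR w).trans (mul_le_of_le_one_right hKR hw)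
    have hCw : ‖C (R w)‖ ≤ KC * KR := (hC _).trans (by gcongr)
    have h1 : f (x + lam • R w) ≤ f x + lam * (Kf * KR) := by
      refine (map_add_le_add f _ _).trans ?_
      rw [map_smul_eq_mul, Real.norm_of_nonneg hlam.le]
      gcongr
      exact (hf _).trans (by gcongr)
    have h2 : lam * f (x + lam • R w) ≤ lam * (f x + lam * (Kf * KR)) := by gcongr
    have h3 : (lam * ‖w‖) ^ 2 ≤ lam ^ 2 := by
      rw [mul_pow]; exact mul_le_of_le_one_right (sq_nonneg _) (pow_le_one₀ (norm_nonneg _) hw)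
    have h4 : tau * (lam * ‖R w‖) ≤ T * lam * (lam * KR) := by
      refine (mul_le_mul_of_nonneg_right htau (by positivity)).trans ?_
      gcongr
    have h6 : (lam * ‖C (R w)‖) ^ 2 ≤ (lam * (KC * KR)) ^ 2 := by gcongr
    have h7 : lam * (inner ℝ r₂ (C (R w)) : ℝ) ≤ lam * (K₂ * lam * (KC * KR)) := by
      refine mul_le_mul_of_nonneg_left ((real_inner_le_norm _ _).trans ?_) hlam.le
      exact mul_le_mul b₂ hCw (norm_nonneg _) ((norm_nonneg _).trans b₂)
    have h5 : lam * ‖r₁‖ ≤ lam * (K₁ * lam) := by rw [hK₁]; nlinarith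
    exact le_of_mul_le_mul_left h5 hlam
  exact ⟨b₁.trans (by gcongr; exact le_max_left _ _), b₂.trans (by gcongr; exact le_max_right _ _)⟩

theorem Seminorm.map_add_smul_le {V : Type*} [AddCommGroup V] [Module ℝ V] (p : Seminorm ℝ V)
    {t : ℝ} (ht : 0 ≤ t) (ht1 : t ≤ 1) (a b : V) :
    p (a + t • b) ≤ (1 - t) * p a + t * p (a + b) := by
  have e : a + t • b = (1 - t) • a + t • (a + b) := by module
  rw [e]
  refine (map_add_le_add p _ _).trans ?_
  rw [map_smul_eq_mul, map_smul_eq_mul, Real.norm_of_nonneg ht, Real.norm_of_nonneg (by linarith)]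

/-- The smooth part of the augmented Lagrangian may be linearized in the subgradient inequality. -/
theorem subgradient_linearize (f : Seminorm ℝ E) (h : Seminorm ℝ S) (A : E →ₗ[ℝ] Q)
    (C : E →ₗ[ℝ] S) {lam : ℝ} (hlam : 0 ≤ lam) {x G : E} {s g : S} {r₁ : Q} {r₂ : S}
    (H : ∀ u w, lam * (f x + h s) + 1 / 2 * ‖r₁‖ ^ 2 + 1 / 2 * ‖r₂‖ ^ 2 + inner ℝ G u + inner ℝ g w ≤
        lam * (f (x + u) + h (s + w)) + 1 / 2 * ‖r₁ + A u‖ ^ 2 + 1 / 2 * ‖r₂ + (C u + w)‖ ^ 2)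
    (u : E) (w : S) :
    lam * (f x + h s) + inner ℝ G u + inner ℝ g w ≤
      lam * (f (x + u) + h (s + w)) + inner ℝ r₁ (A u) + inner ℝ r₂ (C u + w) := by
  set q := 1 / 2 * (‖A u‖ ^ 2 + ‖C u + w‖ ^ 2) with hq
  have hq0 : 0 ≤ q := by positivity
  -- Scale the increment by `t`: by convexity the seminorms change at most proportionally to `t`,
  -- while the quadratic remainder is `t² q`. Divide by `t`, then let `t` tend to `0`.
  have key : ∀ t : ℝ, 0 < t → t ≤ 1 → lam * (f x + h s) + inner ℝ G u + inner ℝ g w ≤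
      lam * (f (x + u) + h (s + w)) + inner ℝ r₁ (A u) + inner ℝ r₂ (C u + w) + t * q := by
    intro t ht ht1
    have H1 := H (t • u) (t • w)
    simp only [map_smul, ← smul_add] at H1
    rw [norm_add_sq_real, norm_add_sq_real, inner_smul_right, inner_smul_right, inner_smul_right,
      inner_smul_right, norm_smul, norm_smul, Real.norm_of_nonneg ht.le] at H1
    have h1 := mul_le_mul_of_nonneg_left (f.map_add_smul_le ht.le ht1 x u) hlam
    have h2 := mul_le_mul_of_nonneg_left (h.map_add_smul_le ht.le ht1 s w) hlam
    refine le_of_mul_le_mul_left ?_ ht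
    rw [hq]
    nlinarith
  refine le_of_forall_pos_le_add fun δ hδ => ?_
  refine (key (min 1 (δ / (q + 1))) (by positivity) (min_le_left _ _)).trans ?_
  gcongr
  calc min 1 (δ / (q + 1)) * q ≤ δ / (q + 1) * q := by gcongr; exact min_le_right _ _
    _ ≤ δ / (q + 1) * (q + 1) := by gcongr; linarith
    _ = δ := by field_simp

end ProximalInequalities

/-- An inequality that holds eventually up to a constant holds everywhere with a larger one. -/
theorem exists_pos_forall_le_mul_of_eventually {a lam : ℕ → ℝ} (hlam : ∀ k, 1 ≤ k → 0 < lam k)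
    {c : ℝ} (h : ∀ᶠ k in atTop, a k ≤ c * lam k) : ∃ C, 0 < C ∧ ∀ k, 1 ≤ k → a k ≤ C * lam k := by
  obtain ⟨N, hN⟩ := eventually_atTop.1 h
  obtain ⟨M, hM⟩ := ((Finset.range N).image fun k => a k / lam k).bddAbove
  refine ⟨max 1 (max c M), by positivity, fun k hk => ?_⟩
  have hl := hlam k hk
  obtain hkN | hkN := lt_or_ge k N
  · have h1 : a k / lam k ≤ M := hM (by simpa using ⟨k, hkN, rfl⟩)
    calc a k ≤ M * lam k := (div_le_iff₀ hl).1 h1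
      _ ≤ _ := by gcongr; exact (le_max_right _ _).trans (le_max_right _ _)
  · exact (hN k hkN).trans (by gcongr; exact (le_max_left _ _).trans (le_max_right _ _))

/-! ### Norm bounds for linear maps in finite dimension. -/

section FiniteDimensional

theorem LinearMap.exists_norm_le {E F : Type*} [NormedAddCommGroup E] [NormedSpace ℝ E]
    [FiniteDimensional ℝ E] [NormedAddCommGroup F] [NormedSpace ℝ F] (T : E →ₗ[ℝ] F) :
    ∃ K, 0 ≤ K ∧ ∀ x, ‖T x‖ ≤ K * ‖x‖ :=
  ⟨‖LinearMap.toContinuousLinearMap T‖, norm_nonneg _,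
    (LinearMap.toContinuousLinearMap T).le_opNorm⟩

/-- Any value of `T` has a preimage of comparable norm. -/
theorem LinearMap.exists_norm_le_map_eq {E F : Type*} [NormedAddCommGroup E] [NormedSpace ℝ E]
    [NormedAddCommGroup F] [NormedSpace ℝ F] [FiniteDimensional ℝ F] (T : E →ₗ[ℝ] F) :
    ∃ K, 0 ≤ K ∧ ∀ x, ∃ x', T x' = T x ∧ ‖x'‖ ≤ K * ‖T x‖ := by
  obtain ⟨R, hR⟩ := T.rangeRestrict.exists_rightInverse_of_surjective (LinearMap.range_rangeRestrict T)
  obtain ⟨K, hK, hb⟩ := R.exists_norm_le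
  refine ⟨K, hK, fun x => ⟨R (T.rangeRestrict x), ?_, hb _⟩⟩
  exact congrArg Subtype.val (LinearMap.congr_fun hR (T.rangeRestrict x))

end FiniteDimensional

/-! ### Vector norms and singular value norms as seminorms. -/

namespace FALC

theorem fact_one_le {p : ℝ≥0∞} (hp : p = 1 ∨ p = 2 ∨ p = ∞) : Fact (1 ≤ p) := by
  rcases hp with rfl | rfl | rfl <;> exact ⟨by norm_num⟩

/-- The `ℓ_p`-norm is a seminorm on Euclidean space. -/
theorem exists_vecSeminorm {p : ℝ≥0∞} (hp : p = 1 ∨ p = 2 ∨ p = ∞) (ι : Type) [Fintype ι] :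
    ∃ N : Seminorm ℝ (EuclideanSpace ℝ ι), ∀ v : EuclideanSpace ℝ ι, N v = vecNorm p v := by
  have := fact_one_le hp
  exact ⟨(normSeminorm ℝ (PiLp p fun _ : ι => ℝ)).comp
    ((WithLp.linearEquiv p ℝ (ι → ℝ)).symm.toLinearMap ∘ₗ
      (WithLp.linearEquiv 2 ℝ (ι → ℝ)).toLinearMap), fun v => rfl⟩

theorem exists_vecNorm_bounds {p : ℝ≥0∞} (hp : p = 1 ∨ p = 2 ∨ p = ∞) (ι : Type) [Fintype ι] :
    ∃ K, 0 ≤ K ∧ ∀ v : EuclideanSpace ℝ ι, vecNorm p v ≤ K * ‖v‖ ∧ ‖v‖ ≤ K * vecNorm p v := by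
  have := fact_one_le hp
  let e : EuclideanSpace ℝ ι ≃ₗ[ℝ] PiLp p fun _ : ι => ℝ :=
    (WithLp.linearEquiv 2 ℝ (ι → ℝ)).trans (WithLp.linearEquiv p ℝ (ι → ℝ)).symm
  obtain ⟨K, hK, h⟩ := e.toLinearMap.exists_norm_le
  obtain ⟨L, hL, h'⟩ := e.symm.toLinearMap.exists_norm_le
  refine ⟨max K L, by positivity, fun v => ⟨(h v).trans ?_, (h' (e v)).trans ?_⟩⟩
  · gcongr; exact le_max_left _ _
  · change L * ‖e v‖ ≤ max K L * ‖e v‖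
    gcongr; exact le_max_right _ _

/-- The norms `‖σ(X)‖_p` are seminorms in `X`, and comparable with the Frobenius norm. -/
theorem exists_sigmaSeminorm {p : ℝ≥0∞} (hp : p = 1 ∨ p = 2 ∨ p = ∞) (m n : ℕ) :
    ∃ N : Seminorm ℝ (EuclideanSpace ℝ (Fin n × Fin m)),
      ∀ X, N (vecEquiv m n X) = vecNorm p (sigma X) := by
  suffices h : ∃ N : Seminorm ℝ (Matrix (Fin m) (Fin n) ℝ), ∀ X, N X = vecNorm p (sigma X) by
    obtain ⟨N, hN⟩ := h
    exact ⟨N.comp (vecEquiv m n).symm.toLinearMap, fun X => by simp [hN]⟩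
  -- Nuclear norm by duality, Frobenius norm by vectorization, spectral norm as an operator norm.
  rcases hp with rfl | rfl | rfl
  · refine ⟨Seminorm.ofSMulLE (fun X => vecNorm 1 (sigma X)) ?_ ?_ ?_, fun X => rfl⟩
    · simp [vecNorm_one_sigma]
    · intro X Y
      simpa only [vecNorm_one_sigma, map_add] using sum_singularValues_add_le (by simp) _ _
    · intro a X
      simpa only [vecNorm_one_sigma, map_smul, Real.norm_eq_abs] using sum_singularValues_smul_le (by simp) _ _
  · exact ⟨(normSeminorm ℝ _).comp (vecEquiv m n).toLinearMap, fun X => (vecNorm_two_sigma X).symm⟩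
  · have hnn : ∀ X : Matrix (Fin m) (Fin n) ℝ, 0 ≤ vecNorm ∞ (sigma X) := fun X => norm_nonneg _
    have hle : ∀ (X : Matrix (Fin m) (Fin n) ℝ) x, ‖Matrix.toEuclideanLin X x‖ ≤ _ := fun X =>
      (vecNorm_top_sigma_le_iff X (hnn X)).1 le_rfl
    refine ⟨Seminorm.ofSMulLE (fun X => vecNorm ∞ (sigma X)) ?_ ?_ ?_, fun X => rfl⟩
    · exact le_antisymm ((vecNorm_top_sigma_le_iff _ le_rfl).2 (by simp)) (hnn _)
    · intro X Y
      refine (vecNorm_top_sigma_le_iff _ (add_nonneg (hnn X) (hnn Y))).2 fun x => ?_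
      rw [map_add, LinearMap.add_apply, add_mul]
      exact (norm_add_le _ _).trans (add_le_add (hle X x) (hle Y x))
    · intro a X
      refine (vecNorm_top_sigma_le_iff _ (mul_nonneg (norm_nonneg a) (hnn X))).2 fun x => ?_
      rw [map_smul, LinearMap.smul_apply, norm_smul, mul_assoc]
      exact mul_le_mul_of_nonneg_left (hle X x) (norm_nonneg a)

/-- Equivalence of norms is applied to the vector `σ(X)`, whose Euclidean norm is the Frobenius norm
of `X`. -/
theorem exists_sigma_bounds {p : ℝ≥0∞} (hp : p = 1 ∨ p = 2 ∨ p = ∞) (m n : ℕ) :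
    ∃ K, 0 ≤ K ∧ ∀ X : Matrix (Fin m) (Fin n) ℝ,
      vecNorm p (sigma X) ≤ K * ‖vecEquiv m n X‖ ∧ ‖vecEquiv m n X‖ ≤ K * vecNorm p (sigma X) := by
  obtain ⟨K, hK, h⟩ := exists_vecNorm_bounds hp (Fin (min m n))
  refine ⟨K, hK, fun X => ?_⟩
  have := h (WithLp.toLp 2 (sigma X))
  rw [← vecNorm_two_sigma]
  exact this

end FALC

/-- With `v` a multiplier and `z` a residual, this turns a bound on the shifted residual into one on
the updated multiplier. -/
theorem norm_sub_inv_smul {V : Type*} [NormedAddCommGroup V] [NormedSpace ℝ V] {a : ℝ} (ha : 0 < a)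
    (v z : V) : ‖v - a⁻¹ • z‖ = a⁻¹ * ‖z - a • v‖ := by
  have e : a⁻¹ • (z - a • v) = a⁻¹ • z - v := by rw [smul_sub, inv_smul_smul₀ ha.ne']
  rw [norm_sub_rev, ← e, norm_smul, Real.norm_of_nonneg (inv_nonneg.2 ha.le)]

/-! ### Inexact augmented Lagrangian runs in Euclidean spaces. -/

section AugmentedLagrangian

variable {E S Q : Type*} [NormedAddCommGroup E] [InnerProductSpace ℝ E]
  [NormedAddCommGroup S] [InnerProductSpace ℝ S] [NormedAddCommGroup Q] [InnerProductSpace ℝ Q]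

/-- The augmented Lagrangian of `min f x + h s` subject to `A x + y = b` and `C x + s = d`. -/
noncomputable def augLag (f : Seminorm ℝ E) (h : Seminorm ℝ S) (A : E →ₗ[ℝ] Q) (C : E →ₗ[ℝ] S)
    (b : Q) (d : S) (lam : ℝ) (θ₁ : Q) (θ₂ : S) (x : E) (s : S) (y : Q) : ℝ :=
  lam * (f x + h s) + 1 / 2 * ‖A x + y - b - lam • θ₁‖ ^ 2 + 1 / 2 * ‖C x + s - d - lam • θ₂‖ ^ 2

/-- An augmented Lagrangian run with inexact solutions of the subproblems over `y ∈ Y`. -/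
structure AugLagRun (f : Seminorm ℝ E) (h : Seminorm ℝ S) (A : E →ₗ[ℝ] Q) (C : E →ₗ[ℝ] S)
    (b : Q) (d : S) (Y : Set Q) (lam eps tau xi : ℕ → ℝ) (x : ℕ → E) (s : ℕ → S) (y : ℕ → Q)
    (θ₁ : ℕ → Q) (θ₂ : ℕ → S) : Prop where
  lam_pos : ∀ k, 1 ≤ k → 0 < lam k
  eps_pos : ∀ k, 1 ≤ k → 0 < eps k
  θ₁_one : θ₁ 1 = 0
  θ₂_one : θ₂ 1 = 0
  y_mem : ∀ k, 1 ≤ k → y k ∈ Y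
  stopping : ∀ k, 1 ≤ k →
    (∀ x' s', ∀ y' ∈ Y, augLag f h A C b d (lam k) (θ₁ k) (θ₂ k) (x k) (s k) (y k) ≤
      augLag f h A C b d (lam k) (θ₁ k) (θ₂ k) x' s' y' + eps k) ∨
    ((∃ G g, (∀ x' s', augLag f h A C b d (lam k) (θ₁ k) (θ₂ k) (x k) (s k) (y k)
        + inner ℝ G (x' - x k) + inner ℝ g (s' - s k) ≤
          augLag f h A C b d (lam k) (θ₁ k) (θ₂ k) x' s' (y k)) ∧ ‖G‖ ≤ tau k ∧ ‖g‖ ≤ tau k) ∧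
      ∀ y' ∈ Y, -xi k ≤ inner ℝ (A (x k) + y k - b - lam k • θ₁ k) (y' - y k))
  θ₁_succ : ∀ k, 1 ≤ k → θ₁ (k + 1) = θ₁ k - (lam k)⁻¹ • (A (x k) + y k - b)
  θ₂_succ : ∀ k, 1 ≤ k → θ₂ (k + 1) = θ₂ k - (lam k)⁻¹ • (C (x k) + s k - d)

namespace AugLagRun

variable {f : Seminorm ℝ E} {h : Seminorm ℝ S} {A : E →ₗ[ℝ] Q} {C : E →ₗ[ℝ] S} {b : Q} {d : S}
  {Y : Set Q} {lam eps tau xi : ℕ → ℝ} {x : ℕ → E} {s : ℕ → S} {y : ℕ → Q} {θ₁ : ℕ → Q}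
  {θ₂ : ℕ → S}

theorem augLag_add (u : E) (w : S) (lam : ℝ) (t₁ : Q) (t₂ : S) (x : E) (s : S) (y : Q) :
    augLag f h A C b d lam t₁ t₂ (x + u) (s + w) y = lam * (f (x + u) + h (s + w))
      + 1 / 2 * ‖(A x + y - b - lam • t₁) + A u‖ ^ 2
      + 1 / 2 * ‖(C x + s - d - lam • t₂) + (C u + w)‖ ^ 2 := by
  rw [augLag, map_add A, map_add C]
  congr 4 <;> congr 1 <;> abel

/-- Multipliers are bounded and constraint residuals are `O(λ)`. -/
theorem exists_bound [FiniteDimensional ℝ E] [FiniteDimensional ℝ Q]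
    (run : AugLagRun f h A C b d Y lam eps tau xi x s y θ₁ θ₂) (hA : Function.Surjective A)
    {Kf Kh : ℝ} (hKf : 0 ≤ Kf) (hKh : 0 ≤ Kh) (hf : ∀ x, f x ≤ Kf * ‖x‖)
    (hh : ∀ s, h s ≤ Kh * ‖s‖) {B : ℝ} (hB : ∀ k, 1 ≤ k → eps k ≤ B * lam k ^ 2)
    (htau : Tendsto (fun k => tau k / lam k) atTop (𝓝 0)) :
    ∃ K, 0 ≤ K ∧ ∀ k, 1 ≤ k →
      ‖A (x k) + y k - b - lam k • θ₁ k‖ ≤ K * lam k ∧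
      ‖C (x k) + s k - d - lam k • θ₂ k‖ ≤ K * lam k ∧
      ‖A (x k) + y k - b‖ ≤ 2 * K * lam k ∧ ‖C (x k) + s k - d‖ ≤ 2 * K * lam k ∧
      ‖θ₁ k‖ ≤ K ∧ ‖θ₂ k‖ ≤ K := by
  -- The absolute value keeps the error term nonnegative also under ε-optimality, where nothing
  -- forces `tau k` to be nonnegative.
  obtain ⟨T, hT, htauT⟩ := exists_pos_forall_le_mul_of_eventually (a := fun k => |tau k|)
    run.lam_pos (c := 1) (by
      filter_upwards [htau.abs.eventually (ge_mem_nhds (by norm_num : |(0 : ℝ)| < 1)),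
        eventually_ge_atTop 1] with k hk hk1
      have hl := run.lam_pos k hk1
      rwa [abs_div, abs_of_pos hl, div_le_iff₀ hl] at hk)
  obtain ⟨R, hR⟩ := A.exists_rightInverse_of_surjective (LinearMap.range_eq_top.2 hA)
  obtain ⟨KR, hKR, hRb⟩ := R.exists_norm_le
  obtain ⟨KC, hKC, hCb⟩ := C.exists_norm_le
  obtain ⟨K, hK⟩ := exists_residual_bound f h A C R (LinearMap.congr_fun hR) hKf hKh hKC hf hh hCb
    hRb hKR B T hT.le
  have hres : ∀ k, 1 ≤ k → ‖A (x k) + y k - b - lam k • θ₁ k‖ ≤ max K 0 * lam k ∧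
      ‖C (x k) + s k - d - lam k • θ₂ k‖ ≤ max K 0 * lam k := by
    intro k hk
    have hl := run.lam_pos k hk
    have := hK (lam k) (eps k) |tau k| (x k) (s k) (A (x k) + y k - b - lam k • θ₁ k)
      (C (x k) + s k - d - lam k • θ₂ k) hl (hB k hk) (htauT k hk) (by
        intro u w
        have e := augLag_add (f := f) (h := h) (A := A) (C := C) (b := b) (d := d) u w (lam k)
          (θ₁ k) (θ₂ k) (x k) (s k) (y k)
        rw [← e]
        have he := run.eps_pos k hk
        have hpos : 0 ≤ |tau k| * (‖u‖ + ‖w‖) := by positivity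
        obtain hs | ⟨⟨G, g, hs, hG, hg⟩, -⟩ := run.stopping k hk
        · have := hs (x k + u) (s k + w) (y k) (run.y_mem k hk)
          rw [augLag] at this
          linarith
        · have := hs (x k + u) (s k + w)
          rw [augLag, add_sub_cancel_left, add_sub_cancel_left] at this
          have h1 := (neg_le_of_abs_le (abs_real_inner_le_norm G u))
          have h2 := (neg_le_of_abs_le (abs_real_inner_le_norm g w))
          have h3 : ‖G‖ * ‖u‖ ≤ |tau k| * ‖u‖ := by gcongr; exact hG.trans (le_abs_self _)
          have h4 : ‖g‖ * ‖w‖ ≤ |tau k| * ‖w‖ := by gcongr; exact hg.trans (le_abs_self _)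
          linarith)
    exact ⟨this.1.trans (by gcongr; exact le_max_left _ _),
      this.2.trans (by gcongr; exact le_max_left _ _)⟩
  have hθ : ∀ k, 1 ≤ k → ‖θ₁ k‖ ≤ max K 0 ∧ ‖θ₂ k‖ ≤ max K 0 := by
    intro k hk
    obtain ⟨j, rfl⟩ := Nat.exists_eq_add_of_le' hk
    obtain rfl | hj := Nat.eq_zero_or_pos j
    · simp [run.θ₁_one, run.θ₂_one]
    · have hl := run.lam_pos j hj
      rw [run.θ₁_succ j hj, run.θ₂_succ j hj]
      obtain ⟨h1, h2⟩ := hres j hj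
      rw [norm_sub_inv_smul hl, norm_sub_inv_smul hl, inv_mul_le_iff₀ hl, inv_mul_le_iff₀ hl,
        mul_comm (lam j)]
      exact ⟨h1, h2⟩
  refine ⟨max K 0, le_max_right _ _, fun k hk => ?_⟩
  obtain ⟨h1, h2⟩ := hres k hk
  obtain ⟨h3, h4⟩ := hθ k hk
  have hl := run.lam_pos k hk
  refine ⟨h1, h2, ?_, ?_, h3, h4⟩
  · calc _ = ‖(A (x k) + y k - b - lam k • θ₁ k) + lam k • θ₁ k‖ := by rw [sub_add_cancel]
      _ ≤ max K 0 * lam k + lam k * max K 0 := by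
        refine (norm_add_le _ _).trans (add_le_add h1 ?_)
        rw [norm_smul, Real.norm_of_nonneg hl.le]
        gcongr
      _ = _ := by ring
  · calc _ = ‖(C (x k) + s k - d - lam k • θ₂ k) + lam k • θ₂ k‖ := by rw [sub_add_cancel]
      _ ≤ max K 0 * lam k + lam k * max K 0 := by
        refine (norm_add_le _ _).trans (add_le_add h2 ?_)
        rw [norm_smul, Real.norm_of_nonneg hl.le]
        gcongr
      _ = _ := by ring

/-- Subtracting a preimage of the residual from `x` gives a point with `A x' - b = -y`, feasible by
the symmetry of `Y`. The seminorms are Lipschitz, so this costs a multiple of the residual. -/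
theorem objective_lower_bound [FiniteDimensional ℝ E] [FiniteDimensional ℝ Q]
    (hA : Function.Surjective A)
    {Kf Kh : ℝ} (hKf : 0 ≤ Kf) (hKh : 0 ≤ Kh) (hf : ∀ x, f x ≤ Kf * ‖x‖)
    (hh : ∀ s, h s ≤ Kh * ‖s‖) (hYneg : ∀ y ∈ Y, -y ∈ Y) :
    ∃ L, 0 ≤ L ∧ ∀ x y xo, y ∈ Y → (∀ x', A x' - b ∈ Y → f xo + h (C xo - d) ≤ f x' + h (C x' - d)) →
      f xo + h (C xo - d) ≤ f x + h (C x - d) + L * ‖A x + y - b‖ := by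
  obtain ⟨R, hR⟩ := A.exists_rightInverse_of_surjective (LinearMap.range_eq_top.2 hA)
  obtain ⟨KR, hKR, hRb⟩ := R.exists_norm_le
  obtain ⟨KC, hKC, hCb⟩ := C.exists_norm_le
  refine ⟨Kf * KR + Kh * (KC * KR), by positivity, fun x y xo hy hopt => ?_⟩
  set r := A x + y - b with hr
  have hAR : A (R r) = r := LinearMap.congr_fun hR r
  refine (hopt (x - R r) ?_).trans ?_
  · have : A (x - R r) - b = -y := by rw [map_sub, hAR, hr]; abel
    exact this ▸ hYneg y hy
  · have h1 : f (x - R r) ≤ f x + Kf * (KR * ‖r‖) :=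
      (map_sub_le_add f _ _).trans (by gcongr; exact (hf _).trans (by gcongr; exact hRb r))
    have h2 : h (C (x - R r) - d) ≤ h (C x - d) + Kh * (KC * (KR * ‖r‖)) := by
      have e : C (x - R r) - d = (C x - d) - C (R r) := by rw [map_sub]; abel
      rw [e]
      refine (map_sub_le_add h _ _).trans ?_
      gcongr
      refine (hh _).trans ?_
      gcongr
      refine (hCb _).trans ?_
      gcongr
      exact hRb r
    linarith

/-- Near-feasible points are, modulo the kernel of the data, bounded by their objective value. -/
theorem exists_dist_bound [FiniteDimensional ℝ E] [FiniteDimensional ℝ S] [FiniteDimensional ℝ Q]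
    {M c : ℝ} (hM : 0 ≤ M) (hc : 0 ≤ c)
    (hcoer : (∀ x, ‖x‖ ≤ M * f x) ∨ ((∀ x, f x = 0) ∧ ∀ s, ‖s‖ ≤ M * h s))
    (hY : ∀ y ∈ Y, ‖y‖ ≤ M) (xo : E) (so : S) :
    ∃ K, 0 ≤ K ∧ ∀ x s y l, 0 ≤ l → y ∈ Y → ‖A x + y - b‖ ≤ c * l → ‖C x + s - d‖ ≤ c * l →
      ∃ u, A (x + u) = A xo ∧ C (x + u) = C xo ∧ f (x + u) ≤ f xo ∧
        ‖u‖ + ‖so - s‖ ≤ K * (1 + l + (f x + h s)) := by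
  have lin : ∀ {a₀ a₁ a₂ l e : ℝ}, 0 ≤ a₀ → 0 ≤ a₁ → 0 ≤ a₂ → 0 ≤ l → 0 ≤ e →
      a₀ + a₁ * l + a₂ * e ≤ (a₀ + a₁ + a₂) * (1 + l + e) := by
    intro a₀ a₁ a₂ l e h0 h1 h2 hl he
    nlinarith [mul_nonneg h0 hl, mul_nonneg h0 he, mul_nonneg h1 he, mul_nonneg h2 hl]
  obtain ⟨KC, hKC, hCb⟩ := C.exists_norm_le
  obtain hco | ⟨hf0, hco⟩ := hcoer
  -- Here `f` bounds `x`, so one can move straight to `xo`; `s` is bounded through the relation `C x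
  -- + s ≈ d`.
  · refine ⟨(‖xo‖ + ‖so‖ + ‖d‖) + c + (M + KC * M), by positivity,
      fun x s y l hl hy h1 h2 => ⟨xo - x, by simp, by simp, by simp, ?_⟩⟩
    refine le_trans ?_ (lin (by positivity) hc (by positivity) hl
      (add_nonneg (apply_nonneg f x) (apply_nonneg h s)))
    have e1 : ‖xo - x‖ ≤ ‖xo‖ + M * f x := (norm_sub_le _ _).trans (by gcongr; exact hco x)
    have e2 : ‖s‖ ≤ c * l + ‖d‖ + KC * (M * f x) := by
      have e : s = (C x + s - d) + d - C x := by abel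
      rw [e]
      refine (norm_sub_le _ _).trans (add_le_add ((norm_add_le _ _).trans (by gcongr)) ?_)
      exact (hCb x).trans (by gcongr; exact hco x)
    have e3 := norm_sub_le so s
    nlinarith [mul_nonneg (add_nonneg hM (mul_nonneg hKC hM)) (apply_nonneg h s)]
  -- Here `x` may drift in the common kernel of `A` and `C`. Only its image under both maps is
  -- bounded, so the displacement is chosen with norm comparable to its image.
  · obtain ⟨K, hK, hKb⟩ := (A.prod C).exists_norm_le_map_eq
    refine ⟨(K * (‖A xo‖ + M + ‖b‖ + ‖C xo‖ + ‖d‖) + ‖so‖) + K * (2 * c) + (K * M + M),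
      by positivity, fun x s y l hl hy h1 h2 => ?_⟩
    obtain ⟨u, hu, hub⟩ := hKb (xo - x)
    have hAu : A u = A (xo - x) := congrArg Prod.fst hu
    have hCu : C u = C (xo - x) := congrArg Prod.snd hu
    refine ⟨u, by rw [map_add, hAu]; simp, by rw [map_add, hCu]; simp, by rw [hf0, hf0], ?_⟩
    refine le_trans ?_ (lin (by positivity) (by positivity) (by positivity) hl
      (add_nonneg (apply_nonneg f x) (apply_nonneg h s)))
    have e1 : ‖A x‖ ≤ c * l + ‖b‖ + M := by
      have e : A x = (A x + y - b) + b - y := by abel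
      rw [e]
      exact (norm_sub_le _ _).trans (add_le_add ((norm_add_le _ _).trans (by gcongr)) (hY y hy))
    have e2 : ‖C x‖ ≤ c * l + ‖d‖ + M * h s := by
      have e : C x = (C x + s - d) + d - s := by abel
      rw [e]
      exact (norm_sub_le _ _).trans (add_le_add ((norm_add_le _ _).trans (by gcongr)) (hco s))
    have e3 : ‖(A.prod C) (xo - x)‖ ≤ (‖A xo‖ + ‖A x‖) + (‖C xo‖ + ‖C x‖) := by
      change ‖(A (xo - x), C (xo - x))‖ ≤ _
      rw [Prod.norm_mk, map_sub, map_sub]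
      refine max_le ((norm_sub_le _ _).trans ?_) ((norm_sub_le _ _).trans ?_)
      · exact le_add_of_nonneg_right (by positivity)
      · exact le_add_of_nonneg_left (by positivity)
    have e4 : ‖u‖ ≤ K * ((‖A xo‖ + (c * l + ‖b‖ + M)) + (‖C xo‖ + (c * l + ‖d‖ + M * h s))) :=
      hub.trans (mul_le_mul_of_nonneg_left (e3.trans (by gcongr)) hK)
    have e5 : ‖so - s‖ ≤ ‖so‖ + M * h s := (norm_sub_le _ _).trans (by gcongr; exact hco s)
    rw [hf0]
    linarith

/-- The value at an `ε`-optimal solution of a subproblem. -/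
theorem value_le_of_epsOptimal {l ε K : ℝ} (hl : 0 < l) {x xo : E} {s : S} {y : Q} {t₁ : Q} {t₂ : S}
    (ht₁ : ‖t₁‖ ≤ K) (ht₂ : ‖t₂‖ ≤ K) {B : ℝ} (hε : ε ≤ B * l ^ 2)
    (H : augLag f h A C b d l t₁ t₂ x s y ≤ augLag f h A C b d l t₁ t₂ xo (d - C xo) (b - A xo) + ε) :
    f x + h s ≤ f xo + h (C xo - d) + (K ^ 2 + B) * l := by
  -- The comparison point has zero residuals, so its penalty is only `λ²(‖t₁‖² + ‖t₂‖²)/2 ≤ K² λ²`.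
  have e1 : A xo + (b - A xo) - b - l • t₁ = -(l • t₁) := by abel
  have e2 : C xo + (d - C xo) - d - l • t₂ = -(l • t₂) := by abel
  rw [augLag, augLag, e1, e2, norm_neg, norm_neg, norm_smul, norm_smul, Real.norm_of_nonneg hl.le,
    map_sub_rev h] at H
  have h1 : (l * ‖t₁‖) ^ 2 ≤ (l * K) ^ 2 := by gcongr
  have h2 : (l * ‖t₂‖) ^ 2 ≤ (l * K) ^ 2 := by gcongr
  refine le_of_mul_le_mul_left ?_ hl
  nlinarith [sq_nonneg ‖A x + y - b - l • t₁‖, sq_nonneg ‖C x + s - d - l • t₂‖]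

/-- The value at an approximately stationary point of a subproblem. -/
theorem value_le_of_stationary {l τ ξ K V : ℝ} (hl : 0 < l) {x u G xo : E} {s g : S} {y : Q} {t₁ : Q}
    {t₂ : S} (H : ∀ x' s', augLag f h A C b d l t₁ t₂ x s y + inner ℝ G (x' - x) + inner ℝ g (s' - s) ≤
          augLag f h A C b d l t₁ t₂ x' s' y) (hG : ‖G‖ ≤ τ) (hg : ‖g‖ ≤ τ)
    (hy : -ξ ≤ inner ℝ (A x + y - b - l • t₁) ((b - A xo) - y))
    (hr₁ : ‖A x + y - b - l • t₁‖ ≤ K * l) (hr₂ : ‖C x + s - d - l • t₂‖ ≤ K * l)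
    (hq₁ : ‖A x + y - b‖ ≤ 2 * K * l) (hq₂ : ‖C x + s - d‖ ≤ 2 * K * l)
    (hAu : A (x + u) = A xo) (hCu : C (x + u) = C xo) (hfu : f (x + u) ≤ f xo)
    (hu : ‖u‖ + ‖(d - C xo) - s‖ ≤ V) :
    f x + h s ≤ f xo + h (C xo - d) + 4 * K ^ 2 * l + ξ / l + τ / l * V := by
  have key := subgradient_linearize f h A C hl.le (x := x) (G := G) (s := s) (g := g)
    (r₁ := A x + y - b - l • t₁) (r₂ := C x + s - d - l • t₂) (fun u w => by
      rw [← augLag_add]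
      simpa [augLag] using H (x + u) (s + w)) u ((d - C xo) - s)
  -- This splits off the displacement in `y`, whose pairing with the shifted residual costs at most
  -- `ξ`; each residual pairing costs at most `2 K² l²`.
  have eA : A u = -(A x + y - b) - ((b - A xo) - y) := by
    rw [← hAu, map_add]; abel
  have eC : C u + ((d - C xo) - s) = -(C x + s - d) := by
    rw [← hCu, map_add]; abel
  rw [eC, eA, inner_sub_right (A x + y - b - l • t₁), inner_neg_right, inner_neg_right,
    add_sub_cancel, map_sub_rev h] at key
  have h1 := neg_le_of_abs_le (abs_real_inner_le_norm (A x + y - b - l • t₁) (A x + y - b))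
  have h2 := neg_le_of_abs_le (abs_real_inner_le_norm (C x + s - d - l • t₂) (C x + s - d))
  have h3 := neg_le_of_abs_le (abs_real_inner_le_norm G u)
  have h4 := neg_le_of_abs_le (abs_real_inner_le_norm g ((d - C xo) - s))
  have hK : 0 ≤ K * l := (norm_nonneg _).trans hr₁
  have hτ : 0 ≤ τ := (norm_nonneg _).trans hG
  have h5 := mul_le_mul hr₁ hq₁ (norm_nonneg _) hK
  have h6 := mul_le_mul hr₂ hq₂ (norm_nonneg _) hK
  have h7 := mul_le_mul_of_nonneg_right hG (norm_nonneg u)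
  have h8 := mul_le_mul_of_nonneg_right hg (norm_nonneg ((d - C xo) - s))
  have h9 := mul_le_mul_of_nonneg_left hu hτ
  have h10 := mul_le_mul_of_nonneg_left hfu hl.le
  refine le_of_mul_le_mul_left ?_ hl
  have e : l * (f xo + h (C xo - d) + 4 * K ^ 2 * l + ξ / l + τ / l * V) =
      l * (f xo + h (C xo - d)) + 4 * K ^ 2 * l ^ 2 + ξ + τ * V := by field_simp
  rw [e]
  nlinarith

/-- Upper half of the rate. At a stationary point the bound on the value contains that value with
coefficient `c τ/λ`, eventually at most `1/2`, which can be moved to the left side. -/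
theorem exists_objective_le [FiniteDimensional ℝ E] [FiniteDimensional ℝ S] [FiniteDimensional ℝ Q]
    (run : AugLagRun f h A C b d Y lam eps tau xi x s y θ₁ θ₂) (hA : Function.Surjective A)
    {M Kf Kh : ℝ} (hM : 0 ≤ M) (hKf : 0 ≤ Kf) (hKh : 0 ≤ Kh) (hf : ∀ x, f x ≤ Kf * ‖x‖)
    (hh : ∀ s, h s ≤ Kh * ‖s‖)
    (hcoer : (∀ x, ‖x‖ ≤ M * f x) ∨ ((∀ x, f x = 0) ∧ ∀ s, ‖s‖ ≤ M * h s))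
    (hY : ∀ y ∈ Y, ‖y‖ ≤ M) {B T Ξ : ℝ} (hB : ∀ k, 1 ≤ k → eps k ≤ B * lam k ^ 2)
    (hT : ∀ k, 1 ≤ k → tau k ≤ T * lam k ^ 2)
    (hΞ : ∀ k, 1 ≤ k → xi k ≤ Ξ * lam k ^ 2)
    (htau : Tendsto (fun k => tau k / lam k) atTop (𝓝 0)) {xo : E} (hxo : b - A xo ∈ Y) :
    ∃ c, 0 < c ∧ ∀ k, 1 ≤ k → f (x k) + h (C (x k) - d) - (f xo + h (C xo - d)) ≤ c * lam k := by
  obtain ⟨K, hK, hb⟩ := run.exists_bound hA hKf hKh hf hh hB htau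
  obtain ⟨c, hc, hdist⟩ := exists_dist_bound (f := f) (h := h) (A := A) (C := C) (b := b) (d := d)
    (Y := Y) hM (by positivity : 0 ≤ 2 * K) hcoer hY xo (d - C xo)
  set F := f xo + h (C xo - d) with hF
  have hF0 : 0 ≤ F := add_nonneg (apply_nonneg f _) (apply_nonneg h _)
  set a := 4 * K ^ 2 + Ξ with ha
  obtain ⟨c', hc', hE⟩ := exists_pos_forall_le_mul_of_eventually
    (a := fun k => f (x k) + h (s k) - F) run.lam_pos
    -- The three entries serve an ε-optimal point, a value already below `F`, and the absorption,
    -- which produces the factor `2`.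
    (c := max (K ^ 2 + B) (max 0 (2 * (a + c * T * (1 + F) + 1 / 2)))) (by
      have hlim : Tendsto (fun k => c * (tau k / lam k)) atTop (𝓝 0) := by
        simpa using htau.const_mul c
      filter_upwards [hlim.eventually (ge_mem_nhds (by norm_num : (0 : ℝ) < 1 / 2)),
        eventually_ge_atTop 1] with k hkτ hk
      have hl := run.lam_pos k hk
      obtain ⟨hr₁, hr₂, hq₁, hq₂, ht₁, ht₂⟩ := hb k hk
      obtain hs | ⟨⟨G, g, hs, hG, hg⟩, hyk⟩ := run.stopping k hk
      · have := value_le_of_epsOptimal hl ht₁ ht₂ (hB k hk) (hs xo (d - C xo) _ hxo)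
        calc f (x k) + h (s k) - F ≤ (K ^ 2 + B) * lam k := by linarith
          _ ≤ _ := by gcongr; exact le_max_left _ _
      · obtain ⟨u, hAu, hCu, hfu, hu⟩ :=
          hdist (x k) (s k) (y k) (lam k) hl.le (run.y_mem k hk) hq₁ hq₂
        have hv := value_le_of_stationary hl hs hG hg (hyk _ hxo) hr₁ hr₂ hq₁ hq₂ hAu hCu hfu hu
        have hξ : xi k / lam k ≤ Ξ * lam k := by
          rw [div_le_iff₀ hl]; linarith [hΞ k hk]
        have hτ : tau k / lam k ≤ T * lam k := by
          rw [div_le_iff₀ hl]; linarith [hT k hk]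
        have hτ0 : 0 ≤ tau k / lam k := div_nonneg ((norm_nonneg _).trans hG) hl.le
        refine le_trans ?_ (mul_le_mul_of_nonneg_right (le_max_right _ _) hl.le)
        obtain hle | hpos := le_total (f (x k) + h (s k)) F
        · exact (sub_nonpos.2 hle).trans (mul_nonneg (le_max_left _ _) hl.le)
        · refine le_trans ?_ (mul_le_mul_of_nonneg_right (le_max_right _ _) hl.le)
          set t := c * (tau k / lam k) with ht
          have ht0 : 0 ≤ t := mul_nonneg hc hτ0
          have ht' : t ≤ c * T * lam k := by
            rw [mul_assoc]; exact mul_le_mul_of_nonneg_left hτ hc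
          have hv' : f (x k) + h (s k) ≤
              F + 4 * K ^ 2 * lam k + Ξ * lam k + t * (1 + lam k + (f (x k) + h (s k))) := by
            have e : tau k / lam k * (c * (1 + lam k + (f (x k) + h (s k)))) =
              t * (1 + lam k + (f (x k) + h (s k))) := by rw [ht]; ring
            rw [e] at hv
            linarith
          have h1 : t * (1 + F) ≤ c * T * lam k * (1 + F) := by gcongr
          have h2 : t * lam k ≤ 1 / 2 * lam k := by gcongr
          have h3 : t * (f (x k) + h (s k) - F) ≤ 1 / 2 * (f (x k) + h (s k) - F) :=
            mul_le_mul_of_nonneg_right hkτ (sub_nonneg.2 hpos)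
          rw [ha]
          linarith)
  refine ⟨c' + Kh * (2 * K), by positivity, fun k hk => ?_⟩
  -- Replacing `s k` by `C (x k) - d` costs only the `O(λ)` residual, since `h` is even.
  have e : C (x k) - d = (C (x k) + s k - d) - s k := by abel
  have h1 : h (C (x k) - d) ≤ Kh * (2 * K * lam k) + h (s k) := by
    rw [e]
    refine (map_sub_le_add h _ _).trans ?_
    gcongr
    exact (hh _).trans (by gcongr; exact (hb k hk).2.2.2.1)
  have := hE k hk
  linarith

/-- Convergence rate of the inexact augmented Lagrangian method. -/
theorem exists_rate [FiniteDimensional ℝ E] [FiniteDimensional ℝ S] [FiniteDimensional ℝ Q]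
    (run : AugLagRun f h A C b d Y lam eps tau xi x s y θ₁ θ₂) (hA : Function.Surjective A)
    {M Kf Kh : ℝ} (hM : 0 ≤ M) (hKf : 0 ≤ Kf) (hKh : 0 ≤ Kh) (hf : ∀ x, f x ≤ Kf * ‖x‖)
    (hh : ∀ s, h s ≤ Kh * ‖s‖)
    (hcoer : (∀ x, ‖x‖ ≤ M * f x) ∨ ((∀ x, f x = 0) ∧ ∀ s, ‖s‖ ≤ M * h s) ∨
      ((∀ x, f x = 0) ∧ ∀ s, h s = 0))
    (hY : ∀ y ∈ Y, ‖y‖ ≤ M) (hYneg : ∀ y ∈ Y, -y ∈ Y) {B T Ξ : ℝ}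
    (hB : ∀ k, 1 ≤ k → eps k ≤ B * lam k ^ 2)
    (hT : ∀ k, 1 ≤ k → tau k ≤ T * lam k ^ 2)
    (hΞ : ∀ k, 1 ≤ k → xi k ≤ Ξ * lam k ^ 2)
    (htau : Tendsto (fun k => tau k / lam k) atTop (𝓝 0)) :
    ∃ c, 0 < c ∧ ∀ k, 1 ≤ k → ‖A (x k) + y k - b‖ ≤ c * lam k ∧
      ∀ xo, A xo - b ∈ Y → (∀ x', A x' - b ∈ Y → f xo + h (C xo - d) ≤ f x' + h (C x' - d)) →
        |f (x k) + h (C (x k) - d) - (f xo + h (C xo - d))| ≤ c * lam k := by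
  obtain ⟨K, hK, hb⟩ := run.exists_bound hA hKf hKh hf hh hB htau
  obtain ⟨L, hL, hlow⟩ := objective_lower_bound (C := C) (b := b) (d := d) hA hKf hKh hf hh hYneg
  -- The constant must not depend on the optimal solution. All of them share one value, so a single
  -- `x₀` suffices.
  obtain ⟨c, hc, hup⟩ : ∃ c, 0 < c ∧ ∀ xo, A xo - b ∈ Y →
      (∀ x', A x' - b ∈ Y → f xo + h (C xo - d) ≤ f x' + h (C x' - d)) → ∀ k, 1 ≤ k →
        f (x k) + h (C (x k) - d) - (f xo + h (C xo - d)) ≤ c * lam k := by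
    by_cases hex : ∃ xo, A xo - b ∈ Y ∧
      ∀ x', A x' - b ∈ Y → f xo + h (C xo - d) ≤ f x' + h (C x' - d)
    · obtain ⟨x₀, hx₀, hopt₀⟩ := hex
      obtain ⟨c, hc, hup⟩ : ∃ c, 0 < c ∧ ∀ k, 1 ≤ k →
          f (x k) + h (C (x k) - d) - (f x₀ + h (C x₀ - d)) ≤ c * lam k := by
        obtain hco | hco | ⟨hf0, hh0⟩ := hcoer
        · exact run.exists_objective_le hA hM hKf hKh hf hh (Or.inl hco) hY hB hT hΞ htau
            (neg_sub (A x₀) b ▸ hYneg _ hx₀)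
        · exact run.exists_objective_le hA hM hKf hKh hf hh (Or.inr hco) hY hB hT hΞ htau
            (neg_sub (A x₀) b ▸ hYneg _ hx₀)
        · exact ⟨1, one_pos, fun k hk => by simpa [hf0, hh0] using (run.lam_pos k hk).le⟩
      exact ⟨c, hc, fun xo hxo hopt k hk =>
        (sub_le_sub_left (hopt₀ xo hxo) _).trans (hup k hk)⟩
    · exact ⟨1, one_pos, fun xo hxo hopt => absurd ⟨xo, hxo, hopt⟩ hex⟩
  refine ⟨max c (max (2 * K) (L * (2 * K))), by positivity, fun k hk => ?_⟩
  have hl := run.lam_pos k hk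
  have hq := (hb k hk).2.2.1
  refine ⟨hq.trans ?_, fun xo hxo hopt => abs_le.2 ⟨?_, (hup xo hxo hopt k hk).trans ?_⟩⟩
  · gcongr; exact (le_max_left _ _).trans (le_max_right _ _)
  · have h1 := hlow (x k) (y k) xo (run.y_mem k hk) hopt
    have h2 : L * ‖A (x k) + y k - b‖ ≤ max c (max (2 * K) (L * (2 * K))) * lam k :=
      calc _ ≤ L * (2 * K * lam k) := by gcongr
        _ = L * (2 * K) * lam k := by ring
        _ ≤ _ := by gcongr; exact (le_max_right _ _).trans (le_max_right _ _)
    linarith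
  · gcongr; exact le_max_left _ _

end AugLagRun

end AugmentedLagrangian

/-! ### Dual norm and gradient in `y`. -/

namespace FALC

/-- Hölder's inequality for the dual norm. -/
theorem neg_mul_dualNorm_le_inner {p : ℝ≥0∞} (hp : p = 1 ∨ p = 2 ∨ p = ∞) {k : ℕ}
    (v w : EuclideanSpace ℝ (Fin k)) {ρ : ℝ} (hw : vecNorm p w ≤ ρ) :
    -(ρ * dualNorm p v) ≤ inner ℝ v w := by
  obtain ⟨N, hN⟩ := exists_vecSeminorm hp (Fin k)
  obtain ⟨K, hK, hb⟩ := exists_vecNorm_bounds hp (Fin k)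
  have hρ : 0 ≤ ρ := (hN w ▸ apply_nonneg N w).trans hw
  obtain rfl | hρ := hρ.eq_or_lt
  · have : ‖w‖ ≤ 0 := (hb w).2.trans (mul_nonpos_of_nonneg_of_nonpos hK hw)
    rw [norm_le_zero_iff] at this
    simp [this]
  -- Test the supremum on `-w/ρ`; norm equivalence supplies the boundedness that a real `sSup`
  -- needs.
  · have hmem : ρ⁻¹ * -(inner ℝ v w : ℝ) ≤ dualNorm p v := by
      refine le_csSup ⟨K * ‖v‖, ?_⟩ ⟨-(ρ⁻¹ • w), ?_, ?_⟩
      · rintro t ⟨z, hz, rfl⟩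
        refine (real_inner_le_norm z v).trans ?_
        gcongr
        exact (hb z).2.trans (mul_le_of_le_one_right hK hz)
      · rw [← hN, map_neg_eq_map, map_smul_eq_mul, hN, Real.norm_of_nonneg (inv_nonneg.2 hρ.le),
          inv_mul_le_iff₀ hρ, mul_one]
        exact hw
      · rw [inner_neg_left, inner_smul_left, real_inner_comm]
        simp
    rw [inv_mul_le_iff₀ hρ] at hmem
    linarith

namespace Problem

variable {m n p q : ℕ} (D : Problem m n p q)

theorem gradY_eq (lam : ℝ) (θ₁ : EuclideanSpace ℝ (Fin q)) (θ₂ : EuclideanSpace ℝ (Fin p))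
    (X : Matrix (Fin m) (Fin n) ℝ) (s : EuclideanSpace ℝ (Fin p)) (y : EuclideanSpace ℝ (Fin q)) :
    D.gradY lam θ₁ θ₂ X s y = D.A X + y - D.b - lam • θ₁ := by
  refine HasGradientAt.gradient ?_
  rw [hasGradientAt_iff_hasFDerivAt]
  have h1 : HasFDerivAt (fun y' : EuclideanSpace ℝ (Fin q) => D.A X + y' - D.b - lam • θ₁)
      (ContinuousLinearMap.id ℝ _) y :=
    (((hasFDerivAt_id y).const_add (D.A X)).sub_const D.b).sub_const (lam • θ₁)
  have h2 := (((h1.norm_sq).const_mul (1 / 2)).const_add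
    (lam * (D.μ₁ * vecNorm D.α (sigma X) + D.μ₂ * vecNorm D.β s))).add_const
    (1 / 2 * ‖D.C X + s - D.d - lam • θ₂‖ ^ 2)
  refine h2.congr_fderiv ?_
  ext z
  simp

end Problem

end FALC

/-! ### Reduction of matrix runs to Euclidean runs. -/

namespace FALC.Problem

variable {m n p q : ℕ} (D : Problem m n p q)

/-- `P` is a sum of nonnegative terms, so its values are bounded below and the real `sInf` is a
genuine infimum. -/
theorem infP_le {lam : ℝ} (hlam : 0 ≤ lam) (θ₁ : EuclideanSpace ℝ (Fin q))
    (θ₂ : EuclideanSpace ℝ (Fin p)) (X : Matrix (Fin m) (Fin n) ℝ) (s : EuclideanSpace ℝ (Fin p))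
    {y : EuclideanSpace ℝ (Fin q)} (hy : vecNorm D.γ y ≤ D.ρ) :
    D.infP lam θ₁ θ₂ ≤ D.P lam θ₁ θ₂ X s y := by
  obtain ⟨Nβ, hβ⟩ := exists_vecSeminorm D.β_mem (Fin p)
  obtain ⟨Nα, hα⟩ := exists_sigmaSeminorm D.α_mem m n
  refine csInf_le ⟨0, ?_⟩ ⟨X, s, y, hy, rfl⟩
  rintro t ⟨X, s, y, -, rfl⟩
  rw [P, ← hβ, ← hα]
  have := D.μ₁_nonneg
  have := D.μ₂_nonneg
  positivity

/-- A run of the algorithm is a run of the augmented Lagrangian method for vectorized matrices. -/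
theorem IsRun.augLagRun {D : Problem m n p q} {lam eps tau xi : ℕ → ℝ}
    {X : ℕ → Matrix (Fin m) (Fin n) ℝ} {s : ℕ → EuclideanSpace ℝ (Fin p)}
    {y : ℕ → EuclideanSpace ℝ (Fin q)} {θ₁ : ℕ → EuclideanSpace ℝ (Fin q)}
    {θ₂ : ℕ → EuclideanSpace ℝ (Fin p)} (run : D.IsRun lam eps tau xi X s y θ₁ θ₂)
    (hlam : ∀ k, 1 ≤ k → 0 < lam k) (heps : ∀ k, 1 ≤ k → 0 < eps k)
    {f : Seminorm ℝ (EuclideanSpace ℝ (Fin n × Fin m))} {h : Seminorm ℝ (EuclideanSpace ℝ (Fin p))}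
    (hf : ∀ X, f (vecEquiv m n X) = D.μ₁ * vecNorm D.α (sigma X))
    (hh : ∀ s : EuclideanSpace ℝ (Fin p), h s = D.μ₂ * vecNorm D.β s) :
    AugLagRun f h (D.A ∘ₗ (vecEquiv m n).symm.toLinearMap) (D.C ∘ₗ (vecEquiv m n).symm.toLinearMap)
      D.b D.d {y | vecNorm D.γ y ≤ D.ρ} lam eps tau xi (fun k => vecEquiv m n (X k)) s y θ₁ θ₂ := by
  have hP : ∀ l t₁ t₂ x s y, augLag f h (D.A ∘ₗ (vecEquiv m n).symm.toLinearMap)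
      (D.C ∘ₗ (vecEquiv m n).symm.toLinearMap) D.b D.d l t₁ t₂ x s y =
        D.P l t₁ t₂ ((vecEquiv m n).symm x) s y := by
    intro l t₁ t₂ x s y
    rw [augLag, P, ← hf, ← hh]
    simp
  refine ⟨hlam, heps, run.θ₁_one, run.θ₂_one, run.inner_feasible, fun k hk => ?_,
    by simpa using run.θ₁_succ, by simpa using run.θ₂_succ⟩
  simp only [hP, LinearEquiv.symm_apply_apply, Set.mem_ofPred_eq]
  refine (run.inner_stop k hk).imp (fun hA x' s' y' hy' => ?_) ?_
  · exact hA.trans (by gcongr; exact D.infP_le (hlam k hk).le _ _ _ _ hy')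
  · rintro ⟨⟨G, g, hsub, hnorm⟩, -, hdual⟩
    rw [frobNorm_eq] at hnorm
    refine ⟨⟨vecEquiv m n G, g, fun x' s' => ?_, ?_, ?_⟩, fun y' hy' => ?_⟩
    · have := hsub ((vecEquiv m n).symm x') s'
      rwa [frobInner_eq, map_sub, LinearEquiv.apply_symm_apply] at this
    · exact (Real.le_sqrt_of_sq_le (by nlinarith [sq_nonneg ‖g‖])).trans hnorm
    · exact (Real.le_sqrt_of_sq_le (by nlinarith [sq_nonneg ‖vecEquiv m n G‖])).trans hnorm
    -- Hölder's inequality at `y'` turns the dual-norm test into the variational inequality `⟨v, y'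
    -- - y⟩ ≥ -ξ`.
    · have h1 := neg_mul_dualNorm_le_inner D.γ_mem (D.gradY (lam k) (θ₁ k) (θ₂ k) (X k) (s k) (y k))
        y' hy'
      rw [gradY_eq] at h1 hdual
      simp only [LinearMap.comp_apply, LinearEquiv.coe_coe, LinearEquiv.symm_apply_apply]
      rw [inner_sub_right]
      linarith

end FALC.Problem

/-! ### The convergence rate for matrices. -/

theorem theorem2 {m n p q : ℕ} (D : FALC.Problem m n p q)
    (lam eps tau xi : ℕ → ℝ) (X : ℕ → Matrix (Fin m) (Fin n) ℝ)
    (s : ℕ → EuclideanSpace ℝ (Fin p)) (y : ℕ → EuclideanSpace ℝ (Fin q))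
    (θ₁ : ℕ → EuclideanSpace ℝ (Fin q)) (θ₂ : ℕ → EuclideanSpace ℝ (Fin p))
    (hrun : D.IsRun lam eps tau xi X s y θ₁ θ₂)
    (B κ₁ κ₂ : ℝ)
    (hlam : ∀ k, 1 ≤ k → 0 < lam k)
    (heps : ∀ k, 1 ≤ k → 0 < eps k)
    (hB : ∀ k, 1 ≤ k → eps k / lam k ^ 2 ≤ B)
    (htau : ∀ k, 1 ≤ k → tau k = κ₁ * eps k)
    (hxi : ∀ k, 1 ≤ k → xi k = κ₂ * eps k)
    (htau_lim : Tendsto (fun k => tau k / lam k) atTop (𝓝 0))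
    (hxi_lim : Tendsto (fun k => xi k / lam k) atTop (𝓝 0)) :
    ∃ c₁ c₂ c₃ : ℝ, 0 < c₁ ∧ 0 < c₂ ∧ 0 < c₃ ∧ ∀ k, 1 ≤ k →
      (FALC.vecNorm D.γ (y k) ≤ D.ρ ∧
        ‖D.A (X k) + y k - D.b‖ ≤ c₁ * lam k) ∧
      ∀ Xopt, D.IsOptimal Xopt →
        |D.objective (X k) - D.objective Xopt| ≤ c₂ * lam k + c₃ * √(eps k) := by
  have hle : ∀ (t : ℕ → ℝ) (κ : ℝ), (∀ k, 1 ≤ k → t k = κ * eps k) →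
      ∀ k, 1 ≤ k → t k ≤ |κ| * B * lam k ^ 2 := fun t κ ht k hk => by
    have hε : eps k ≤ B * lam k ^ 2 := (div_le_iff₀ (pow_pos (hlam k hk) 2)).1 (hB k hk)
    rw [ht k hk, mul_assoc]
    exact (mul_le_mul_of_nonneg_right (le_abs_self κ) (heps k hk).le).trans (by gcongr)
  obtain ⟨Nα, hα⟩ := FALC.exists_sigmaSeminorm D.α_mem m n
  obtain ⟨Nβ, hβ⟩ := FALC.exists_vecSeminorm D.β_mem (Fin p)
  obtain ⟨Nγ, hγ⟩ := FALC.exists_vecSeminorm D.γ_mem (Fin q)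
  obtain ⟨Kα, hKα, hbα⟩ := FALC.exists_sigma_bounds D.α_mem m n
  obtain ⟨Kβ, hKβ, hbβ⟩ := FALC.exists_vecNorm_bounds D.β_mem (Fin p)
  obtain ⟨Kγ, hKγ, hbγ⟩ := FALC.exists_vecNorm_bounds D.γ_mem (Fin q)
  have h₁ := D.μ₁_nonneg
  have h₂ := D.μ₂_nonneg
  have hρ := D.ρ_nonneg
  let f : Seminorm ℝ (EuclideanSpace ℝ (Fin n × Fin m)) := D.μ₁.toNNReal • Nα
  let h : Seminorm ℝ (EuclideanSpace ℝ (Fin p)) := D.μ₂.toNNReal • Nβ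
  have hf : ∀ Z, f (FALC.vecEquiv m n Z) = D.μ₁ * FALC.vecNorm D.α (FALC.sigma Z) := fun Z => by
    rw [← hα, ← Real.coe_toNNReal _ h₁]; rfl
  have hh : ∀ z : EuclideanSpace ℝ (Fin p), h z = D.μ₂ * FALC.vecNorm D.β z := fun z => by
    rw [← hβ, ← Real.coe_toNNReal _ h₂]; rfl
  have run := hrun.augLagRun hlam heps hf hh
  -- One constant serves all cases: for a zero weight the quotient `K / 0` is `0`.
  have hcoer : (∀ x, ‖x‖ ≤ (Kα / D.μ₁ + Kβ / D.μ₂ + Kγ * D.ρ) * f x) ∨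
      ((∀ x, f x = 0) ∧ ∀ z, ‖z‖ ≤ (Kα / D.μ₁ + Kβ / D.μ₂ + Kγ * D.ρ) * h z) ∨
      ((∀ x, f x = 0) ∧ ∀ z, h z = 0) := by
    obtain h₁' | h₁' := h₁.eq_or_lt
    · have hf0 : ∀ x, f x = 0 := fun x => by
        rw [← (FALC.vecEquiv m n).apply_symm_apply x, hf, ← h₁', zero_mul]
      obtain h₂' | h₂' := h₂.eq_or_lt
      · exact Or.inr (Or.inr ⟨hf0, fun z => by rw [hh, ← h₂', zero_mul]⟩)
      · refine Or.inr (Or.inl ⟨hf0, fun z => ?_⟩)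
        calc ‖z‖ ≤ Kβ * FALC.vecNorm D.β z := (hbβ z).2
          _ = Kβ / D.μ₂ * h z := by rw [hh]; field_simp
          _ ≤ _ := by
            gcongr
            have : 0 ≤ Kα / D.μ₁ := by positivity
            have : 0 ≤ Kγ * D.ρ := by positivity
            linarith
    · refine Or.inl fun x => ?_
      obtain ⟨Z, rfl⟩ := (FALC.vecEquiv m n).surjective x
      calc ‖FALC.vecEquiv m n Z‖ ≤ Kα * FALC.vecNorm D.α (FALC.sigma Z) := (hbα Z).2
        _ = Kα / D.μ₁ * f (FALC.vecEquiv m n Z) := by rw [hf]; field_simp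
        _ ≤ _ := by
          gcongr
          have : 0 ≤ Kβ / D.μ₂ := by positivity
          have : 0 ≤ Kγ * D.ρ := by positivity
          linarith
  obtain ⟨c, hc, hrate⟩ := run.exists_rate (M := Kα / D.μ₁ + Kβ / D.μ₂ + Kγ * D.ρ)
    (Kf := D.μ₁ * Kα) (Kh := D.μ₂ * Kβ) (B := B) (T := |κ₁| * B) (Ξ := |κ₂| * B)
    (D.A_surjective.comp (FALC.vecEquiv m n).symm.surjective) (by positivity) (by positivity)
    (by positivity)
    (fun x => by
      obtain ⟨Z, rfl⟩ := (FALC.vecEquiv m n).surjective x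
      rw [hf, mul_assoc]
      exact mul_le_mul_of_nonneg_left (hbα Z).1 h₁)
    (fun z => by rw [hh, mul_assoc]; exact mul_le_mul_of_nonneg_left (hbβ z).1 h₂)
    hcoer
    (fun z hz => by
      refine (hbγ z).2.trans ?_
      have : Kγ * FALC.vecNorm D.γ z ≤ Kγ * D.ρ := mul_le_mul_of_nonneg_left hz hKγ
      have : 0 ≤ Kα / D.μ₁ := by positivity
      have : 0 ≤ Kβ / D.μ₂ := by positivity
      linarith)
    (fun z hz => by
      rw [Set.mem_ofPred_eq, ← hγ, map_neg_eq_map, hγ]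
      exact hz)
    (fun k hk => (div_le_iff₀ (pow_pos (hlam k hk) 2)).1 (hB k hk))
    (hle tau κ₁ htau) (hle xi κ₂ hxi) htau_lim
  have hobj : ∀ Z, D.objective Z = f (FALC.vecEquiv m n Z) + h (D.C Z - D.d) := fun Z => by
    rw [FALC.Problem.objective, hf, hh]
  -- The error is already `O(λ)`; the square root term is nonnegative slack, so any positive `c₃`
  -- works.
  refine ⟨c, c, 1, hc, hc, one_pos, fun k hk => ?_⟩
  obtain ⟨hA, hF⟩ := hrate k hk
  refine ⟨⟨hrun.inner_feasible k hk, by simpa using hA⟩, fun Xopt hopt => ?_⟩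
  have hXo := hF (FALC.vecEquiv m n Xopt) (by simpa using! hopt.1) (fun x' hx' => by
    have := hopt.2 ((FALC.vecEquiv m n).symm x') hx'
    rw [hobj, hobj, LinearEquiv.apply_symm_apply] at this
    simpa using this)
  rw [hobj, hobj]
  simp only [LinearMap.comp_apply, LinearEquiv.coe_coe, LinearEquiv.symm_apply_apply] at hXo
  exact hXo.trans (le_add_of_nonneg_right (by positivity))
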